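/- Let $\Phi$ be a homogeneous Poisson point process of intensity $\lambda>0$ in $\mathbb{R}^2$, whose points $b$ are the base stations (BSs), all transmitting with power $P>0$, and let $\eta>2$, $T>0$. Conditionally on $\Phi$, let the channel power gains $h_b$ $(b\in\Phi)$ be independent and exponentially distributed with mean $1$. Fix the location $u\in\mathbb{R}^2$ of a test user, and let $r_b=\|b-u\|$; the user receives the power $P h_b r_b^{-\eta}$ from $b$. In the best connected case, the serving BS $b_0$ is the BS nearest to $u$, and $I_r=\sum_{b\in\Phi\setminus\{b_0\}}P h_b r_b^{-\eta}$. In the blackout case, the BS $b_1$ nearest to $u$ is skipped, the serving BS $b_0$ is the second nearest BS, $I_r=\sum_{b\in\Phi\setminus\{b_0,b_1\}}P h_b r_b^{-\eta}$, and $I_1=P h_{b_1}r_{b_1}^{-\eta}$. In both cases let $r_0=r_{b_0}$ be the serving distance, and let $\mathscr{L}_{I}\left(\frac{Tr_0^\eta}{P}\right)=\mathbb{E}\left[\exp\left(-\frac{Tr_0^\eta}{P}\,I\right)\,\middle|\,r_0\right]$ denote the conditional Laplace transform of $I$ given $r_0$, evaluated at $s=Tr_0^\eta/P$. Then the received powers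 are almost surely summable over $\Phi$, and, almost surely, in the best connected case and in the blackout case, $$\mathscr{L}_{I_r}\left(\frac{Tr_0^\eta}{P}\right)=\exp\left(-\pi\lambda r_0^2\,\vartheta(T,\eta)\right),\qquad \vartheta(T,\eta)=T^{2/\eta}\int_{T^{-2/\eta}}^{\infty}\frac{dw}{1+w^{\eta/2}},$$ and in the blackout case $$\mathscr{L}_{I_1}\left(\frac{Tr_0^\eta}{P}\right)=\int_0^{r_0}\frac{1}{1+Tr_0^\eta r^{-\eta}}\,\frac{2r}{r_0^2}\,dr.$$ -/

import Mathlib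

open MeasureTheory ProbabilityTheory
open scoped ENNReal NNReal

noncomputable section

/-- The number (with multiplicity, possibly infinite) of terms of the sequence `x` in `A`. -/
def pointCount {E : Type*} (x : ℕ → E) (A : Set E) : ℝ≥0∞ :=
  ∑' n, A.indicator (fun _ => 1) (x n)

/-- The random points `X 0, X 1, …`, listed in an arbitrary measurable way, form a Poisson point
process with intensity measure `ν` (of infinite total mass, as the list is infinite):
the number of points in a measurable set `A` of finite intensity is Poisson
distributed with mean `ν A`, and the numbers of points in disjoint sets are independent. -/
structure IsPoissonPointProcess {Ω E : Type*} [MeasurableSpace Ω] [MeasurableSpace E]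
    (X : ℕ → Ω → E) (ν : Measure E) (μ : Measure Ω) : Prop where
  measurable : ∀ n, Measurable (X n)
  map_count : ∀ A : Set E, MeasurableSet A → ν A ≠ ∞ →
    μ.map (fun ω => pointCount (fun n => X n ω) A) =
      (poissonMeasure (ν A).toNNReal).map (fun k : ℕ => (k : ℝ≥0∞))
  indep_count : ∀ (k : ℕ) (A : Fin k → Set E), (∀ i, MeasurableSet (A i)) →
    Pairwise (fun i j => Disjoint (A i) (A j)) →
      iIndepFun (fun i ω => pointCount (fun n => X n ω) (A i)) μ

/-- The index of the nearest point, given the sequence `d` of distances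
(ties are broken by the smaller index). -/
def nearestIdx (d : ℕ → ℝ) : ℕ := sInf {n | ∀ m, d n ≤ d m}

/-- The index of the second nearest point, given the sequence `d` of distances. -/
def secondNearestIdx (d : ℕ → ℝ) : ℕ :=
  sInf {n | n ≠ nearestIdx d ∧ ∀ m, m ≠ nearestIdx d → d n ≤ d m}

/-- The power received over the distance `d` from a station of transmit power `P`, with path
loss exponent `η` and channel power gain `h`. -/
def rxPower (P η h d : ℝ) : ℝ := P * h * d ^ (-η)

/-- The aggregate power received from all stations whose index is not in `S`. -/
def interferenceExcept (P η : ℝ) (h d : ℕ → ℝ) (S : Set ℕ) : ℝ :=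
  ∑' n, Sᶜ.indicator (fun n => rxPower P η (h n) (d n)) n

/-- The conditional Laplace transform `𝔼[exp (-s(R) I) | R]` of `I` given `R`, at the point
`s(R)`; a random variable that is a function of `R`. -/
def condLaplace {Ω : Type*} [MeasurableSpace Ω] (μ : Measure Ω) (I R : Ω → ℝ) (s : ℝ → ℝ) :
    Ω → ℝ :=
  μ[fun ω => Real.exp (-(s (R ω)) * I ω) | MeasurableSpace.comap R inferInstance]

/-- `ϑ(T, η) = T ^ (2/η) ∫_{T ^ (-2/η)}^∞ 1 / (1 + w ^ (η/2)) dw`. -/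
def vartheta (T η : ℝ) : ℝ :=
  T ^ (2 / η) * ∫ w in Set.Ioi (T ^ (-2 / η)), 1 / (1 + w ^ (η / 2))

end

/-! Write `R` for the serving distance. Given the stations, each exponential gain integrates out to
`1 / (1 + T (R / r) ^ η)`, so the interference contributes `exp (-∑ log (1 + T (R / r) ^ η))`, a
functional of the point process alone (`setIntegral_exp_neg_tsum_mul`). Since `R > 0` almost surely,
a nonnegative variable has conditional expectation `g R` as soon as its integrals over the events
`{b < R}`, `b ≥ 0`, agree with those of `g R` (`condExp_comap_ae_eq_of_setIntegral_Ioi`).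

Neither Palm calculus nor the density of `R` is needed for these integrals. The event `{s < R}` says
that the disc of radius `s` holds no station (best connected case) or at most one (blackout case).
If `R` inside the functional is frozen at a constant `a ≥ s`, the sum runs over stations beyond `a`,
hence is independent of that event, and the Laplace functional (`integral_mul_exp_neg_tsum`) gives
`exp (-π λ a ^ 2 ϑ)`. Differences give the identity on the cells `{s < R ≤ a}`. Summing over a grid
of cells and refining the mesh lets `a` tend to `R` under dominated convergence
(`setIntegral_Ioi_eq_of_frozen`).

For the skipped nearest station at distance `r`, the same freezing, now at the left end of each
cell, shows that `(r / R) ^ 2` is uniform on `(0, 1)` given `R > b` (`map_restrict_sq_ratio`). Thus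
its averaged attenuation is a constant, and the substitution `v = (y / R) ^ 2` identifies that
constant with the stated integral.

Almost surely the distances are positive, distinct and locally finite. This makes the two nearest
indices well behaved and turns the exclusion of indices into the condition of lying beyond `R`. -/

/-! ### Poisson point processes: counts, Campbell's formula, Laplace functional. -/

theorem pointCount_eq_encard {E : Type*} (x : ℕ → E) (A : Set E) :
    pointCount x A = ({n | x n ∈ A}.encard : ℝ≥0∞) := by
  rw [← ENNReal.tsum_set_one, pointCount, tsum_subtype {n | x n ∈ A} (fun _ => (1 : ℝ≥0∞))]
  rfl

theorem pointCount_closedBall {E : Type*} [PseudoMetricSpace E] (x : ℕ → E) (u : E) (s : ℝ) :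
    pointCount x (Metric.closedBall u s) = ({n | dist u (x n) ≤ s}.encard : ℝ≥0∞) := by
  rw [pointCount_eq_encard]
  congr 2
  exact Set.ext fun n => Metric.mem_closedBall'

theorem measurable_pointCount {Ω E : Type*} [MeasurableSpace Ω] [MeasurableSpace E]
    {X : ℕ → Ω → E} (hX : ∀ n, Measurable (X n)) {A : Set E} (hA : MeasurableSet A) :
    Measurable fun ω => pointCount (fun n => X n ω) A :=
  Measurable.tsum fun n => (measurable_const.indicator hA).comp (hX n)

theorem lintegral_natCast_poissonMeasure (r : ℝ≥0) :
    ∫⁻ k, (k : ℝ≥0∞) ∂(poissonMeasure r) = r := by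
  rw [lintegral_countable']
  simp only [poissonMeasure_singleton]
  rw [tsum_eq_zero_add' ENNReal.summable]
  -- The weights satisfy `(n + 1) p (n + 1) = r p n`, so the mean is `r` times the total mass.
  have h (n : ℕ) : ((n + 1 : ℕ) : ℝ≥0∞) *
      ENNReal.ofReal (Real.exp (-r) * r ^ (n + 1) / (n + 1).factorial) =
      r * ENNReal.ofReal (Real.exp (-r) * r ^ n / n.factorial) := by
    rw [← ENNReal.ofReal_natCast, ← ENNReal.ofReal_coe_nnreal, ← ENNReal.ofReal_mul (by positivity),
      ← ENNReal.ofReal_mul (by positivity)]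
    congr 1
    rw [Nat.factorial_succ]
    push_cast
    field_simp
    ring
  have h1 := measure_univ (μ := poissonMeasure r)
  rw [← lintegral_one, lintegral_countable'] at h1
  simp only [poissonMeasure_singleton, one_mul] at h1
  rw [tsum_congr h, ENNReal.tsum_mul_left, h1]
  simp

namespace IsPoissonPointProcess

variable {Ω E : Type*} [MeasurableSpace Ω] [MeasurableSpace E] {X : ℕ → Ω → E} {ν : Measure E}
  {μ : Measure Ω}

theorem measure_pointCount_eq (hX : IsPoissonPointProcess X ν μ) {A : Set E}
    (hA : MeasurableSet A) (hν : ν A ≠ ∞) (k : ℕ) :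
    μ {ω | pointCount (fun n => X n ω) A = k} =
      ENNReal.ofReal (Real.exp (-(ν A).toReal) * (ν A).toReal ^ k / k.factorial) := by
  have h := congrArg (fun m => m {(k : ℝ≥0∞)}) (hX.map_count A hA hν)
  beta_reduce at h
  rw [Measure.map_apply (measurable_pointCount hX.measurable hA) (measurableSet_singleton _),
    Measure.map_apply (by fun_prop) (measurableSet_singleton _)] at h
  have h2 : (fun k : ℕ => (k : ℝ≥0∞)) ⁻¹' {(k : ℝ≥0∞)} = {k} := by ext; simp
  rw [h2, poissonMeasure_singleton] at h
  exact h

theorem ae_pointCount_ne_top (hX : IsPoissonPointProcess X ν μ) {A : Set E}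
    (hA : MeasurableSet A) (hν : ν A ≠ ∞) :
    ∀ᵐ ω ∂μ, pointCount (fun n => X n ω) A ≠ ∞ := by
  have h := congrArg (fun m => m {∞}) (hX.map_count A hA hν)
  beta_reduce at h
  rw [Measure.map_apply (measurable_pointCount hX.measurable hA) (measurableSet_singleton _),
    Measure.map_apply (by fun_prop) (measurableSet_singleton _)] at h
  have h2 : (fun k : ℕ => (k : ℝ≥0∞)) ⁻¹' {∞} = ∅ := by ext; simp
  rw [h2, measure_empty] at h
  rw [ae_iff]
  simp only [ne_eq, not_not]
  exact h

theorem lintegral_pointCount (hX : IsPoissonPointProcess X ν μ) {A : Set E}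
    (hA : MeasurableSet A) (hν : ν A ≠ ∞) :
    ∫⁻ ω, pointCount (fun n => X n ω) A ∂μ = ν A := by
  have h := congrArg (fun m => ∫⁻ x, x ∂m) (hX.map_count A hA hν)
  beta_reduce at h
  rw [lintegral_map (f := fun x => x) measurable_id (measurable_pointCount hX.measurable hA),
    lintegral_map (f := fun x => x) measurable_id (by fun_prop), lintegral_natCast_poissonMeasure] at h
  simpa [hν] using h

/-- The expected count of a set of finite intensity is the Poisson mean. As the counts of other sets
are not prescribed, the equality of measures is obtained by restricting to `spanningSets`. -/
theorem sum_map_eq (hX : IsPoissonPointProcess X ν μ) [SigmaFinite ν] :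
    Measure.sum (fun n => μ.map (X n)) = ν := by
  have key (A : Set E) (hA : MeasurableSet A) (hν : ν A ≠ ∞) :
      Measure.sum (fun n => μ.map (X n)) A = ν A := by
    rw [Measure.sum_apply _ hA, ← hX.lintegral_pointCount hA hν]
    simp only [pointCount]
    rw [lintegral_tsum (f := fun n ω => A.indicator (fun _ => (1 : ℝ≥0∞)) (X n ω))
      fun n => ((measurable_const.indicator hA).comp (hX.measurable n)).aemeasurable]
    refine tsum_congr fun n => ?_
    rw [Measure.map_apply (hX.measurable n) hA, ← lintegral_indicator_one (hX.measurable n hA)]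
    rfl
  refine (Measure.ext_iff_of_iUnion_eq_univ (iUnion_spanningSets ν)).2 fun i => ?_
  ext A hA
  rw [Measure.restrict_apply hA, Measure.restrict_apply hA]
  exact key _ (hA.inter (measurableSet_spanningSets ν i))
    ((measure_mono Set.inter_subset_right).trans_lt (measure_spanningSets_lt_top ν i)).ne

/-- Campbell's formula, used to see that random sums over the points are almost surely finite. -/
theorem lintegral_tsum_comp (hX : IsPoissonPointProcess X ν μ) [SigmaFinite ν] {f : E → ℝ≥0∞}
    (hf : Measurable f) : ∫⁻ ω, ∑' n, f (X n ω) ∂μ = ∫⁻ x, f x ∂ν := by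
  rw [lintegral_tsum (f := fun n ω => f (X n ω))
    fun n => (hf.comp (hX.measurable n)).aemeasurable]
  conv_rhs => rw [← hX.sum_map_eq]
  rw [lintegral_sum_measure]
  exact tsum_congr fun n => (lintegral_map hf (hX.measurable n)).symm

theorem iIndepFun_pointCount (hX : IsPoissonPointProcess X ν μ) {ι : Type*} [Fintype ι]
    {A : ι → Set E} (hA : ∀ i, MeasurableSet (A i)) (hd : Pairwise fun i j => Disjoint (A i) (A j)) :
    iIndepFun (fun i ω => pointCount (fun n => X n ω) (A i)) μ := by
  have h := hX.indep_count (Fintype.card ι) (fun i => A ((Fintype.equivFin ι).symm i))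
    (fun i => hA _) (fun i j hij => hd (by simpa using hij))
  simpa using h.precomp (Fintype.equivFin ι).injective

theorem integral_exp_neg_pointCount (hX : IsPoissonPointProcess X ν μ) {A : Set E}
    (hA : MeasurableSet A) (hν : ν A ≠ ∞) (c : ℝ) :
    ∫ ω, Real.exp (-(c * (pointCount (fun n => X n ω) A).toReal)) ∂μ =
      Real.exp (-((1 - Real.exp (-c)) * (ν A).toReal)) := by
  have hg : Measurable fun x : ℝ≥0∞ => Real.exp (-(c * x.toReal)) := by fun_prop
  have h := congrArg (fun m => ∫ x, Real.exp (-(c * x.toReal)) ∂m) (hX.map_count A hA hν)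
  beta_reduce at h
  rw [integral_map (measurable_pointCount hX.measurable hA).aemeasurable hg.aestronglyMeasurable,
    integral_map (by fun_prop) hg.aestronglyMeasurable, integral_poissonMeasure] at h
  rw [h]
  set r := (ν A).toNNReal
  have h2 := (NormedSpace.expSeries_div_hasSum_exp ((r : ℝ) * Real.exp (-c))).mul_left
    (Real.exp (-r))
  rw [← Real.exp_eq_exp_ℝ, ← Real.exp_add] at h2
  have h3 : (ν A).toReal = r := rfl
  rw [h3, show -((1 - Real.exp (-c)) * (r : ℝ)) = -r + r * Real.exp (-c) by ring, ← h2.tsum_eq]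
  refine tsum_congr fun n => ?_
  rw [mul_pow, ← Real.exp_nat_mul, ENNReal.toReal_natCast, smul_eq_mul]
  rw [show -(c * (n : ℝ)) = n * -c by ring]
  ring

end IsPoissonPointProcess

namespace IsPoissonPointProcess

variable {Ω E : Type*} [MeasurableSpace Ω] [MeasurableSpace E] {X : ℕ → Ω → E} {ν : Measure E}
  {μ : Measure Ω}

/-- Laplace functional of finitely many disjoint weighted sets, jointly with the number of points
in another disjoint set. -/
theorem integral_mul_exp_neg_sum (hX : IsPoissonPointProcess X ν μ) {ι : Type*} [Fintype ι]
    {B : Set E} (hB : MeasurableSet B) {A : ι → Set E} (hA : ∀ i, MeasurableSet (A i))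
    (hνA : ∀ i, ν (A i) ≠ ∞) (hd : Pairwise fun i j => Disjoint (A i) (A j))
    (hAB : ∀ i, Disjoint B (A i)) {φ : ℝ≥0∞ → ℝ} (hφ : Measurable φ) (c : ι → ℝ) :
    ∫ ω, φ (pointCount (fun n => X n ω) B) *
        Real.exp (-∑ i, c i * (pointCount (fun n => X n ω) (A i)).toReal) ∂μ =
      (∫ ω, φ (pointCount (fun n => X n ω) B) ∂μ) *
        Real.exp (-∑ i, (1 - Real.exp (-c i)) * (ν (A i)).toReal) := by
  -- The index `none` carries `B` and the function `φ`, so that a single product formula for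
  -- independent counts covers both factors.
  let A' : Option ι → Set E := fun o => o.elim B A
  have hA' : ∀ o, MeasurableSet (A' o) := by
    rintro (_ | i)
    exacts [hB, hA i]
  have hd' : Pairwise fun o p => Disjoint (A' o) (A' p) := by
    rintro (_ | i) (_ | j) h
    · exact absurd rfl h
    · exact hAB j
    · exact (hAB i).symm
    · exact hd (by simpa using h)
  let f : Option ι → ℝ≥0∞ → ℝ := fun o =>
    o.elim φ fun i x => Real.exp (-(c i * x.toReal))
  have hf : ∀ o, Measurable (f o) := by
    rintro (_ | i)
    · exact hφ
    · change Measurable fun x : ℝ≥0∞ => Real.exp (-(c i * x.toReal))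
      fun_prop
  have h := (hX.iIndepFun_pointCount hA' hd').integral_fun_prod_comp (f := f)
    (fun o => (measurable_pointCount hX.measurable (hA' o)).aemeasurable)
    (fun o => (hf o).aestronglyMeasurable)
  simp only [Fintype.prod_option] at h
  have h1 (i : ι) : ∫ ω, f (some i) (pointCount (fun n => X n ω) (A' (some i))) ∂μ =
      Real.exp (-((1 - Real.exp (-c i)) * (ν (A i)).toReal)) :=
    hX.integral_exp_neg_pointCount (hA i) (hνA i) (c i)
  simp only [h1, ← Real.exp_sum, Finset.sum_neg_distrib] at h
  refine Eq.trans (integral_congr_ae (Filter.Eventually.of_forall fun ω => ?_)) h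
  simp only [f, A', Option.elim, ← Real.exp_sum, Finset.sum_neg_distrib]

/-- The level sets of `s` at nonzero values are disjoint from each other and from `B`, and have
finite intensity because `s` is integrable, so the finite case applies to them. The value `0` is
left out, as its level set may have infinite intensity and contributes nothing. -/
theorem integral_mul_exp_neg_tsum_simpleFunc (hX : IsPoissonPointProcess X ν μ)
    {B : Set E} (hB : MeasurableSet B) {φ : ℝ≥0∞ → ℝ} (hφ : Measurable φ) (s : SimpleFunc E ℝ≥0∞)
    (hsB : ∀ x ∈ B, s x = 0) (hs : ∀ x, s x ≠ ∞) (hsi : ∫⁻ x, s x ∂ν ≠ ∞) :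
    ∫ ω, φ (pointCount (fun n => X n ω) B) *
        Real.exp (-(∑' n, s (X n ω)).toReal) ∂μ =
      (∫ ω, φ (pointCount (fun n => X n ω) B) ∂μ) *
        Real.exp (-∫ x, (1 - Real.exp (-(s x).toReal)) ∂ν) := by
  classical
  let ι := {c // c ∈ s.range.filter (· ≠ 0)}
  have : Fintype ι := inferInstanceAs (Fintype {c // c ∈ s.range.filter (· ≠ 0)})
  let A : ι → Set E := fun c => s ⁻¹' {c.1}
  have hA : ∀ c, MeasurableSet (A c) := fun c => s.measurableSet_preimage _
  have hc0 : ∀ c : ι, c.1 ≠ 0 := fun c => (Finset.mem_filter.1 c.2).2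
  have hctop : ∀ c : ι, c.1 ≠ ∞ := by
    intro c
    obtain ⟨x, hx⟩ := SimpleFunc.mem_range.1 (Finset.mem_filter.1 c.2).1
    exact hx ▸ hs x
  have hνA : ∀ c, ν (A c) ≠ ∞ := by
    intro c h
    refine hsi (top_le_iff.1 ?_)
    calc ∞ = c.1 * ν (A c) := by rw [h, ENNReal.mul_top (hc0 c)]
      _ = ∫⁻ x, (A c).indicator (fun _ => c.1) x ∂ν := by rw [lintegral_indicator_const (hA c)]
      _ ≤ _ := lintegral_mono fun x => Set.indicator_le (fun x hx => (by
          simpa [A] using (Set.mem_singleton_iff.1 hx).ge)) x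
  have hd : Pairwise fun c c' : ι => Disjoint (A c) (A c') := by
    intro c c' h
    refine Set.disjoint_left.2 fun x hx hx' => h (Subtype.ext ?_)
    exact (Set.mem_singleton_iff.1 hx).symm.trans (Set.mem_singleton_iff.1 hx')
  have hAB : ∀ c, Disjoint B (A c) := by
    intro c
    refine Set.disjoint_left.2 fun x hx hx' => hc0 c ?_
    exact (Set.mem_singleton_iff.1 hx').symm.trans (hsB x hx)
  have hdec {M : Type} [AddCommMonoid M] (g : ℝ≥0∞ → M) (hg : g 0 = 0) (x : E) :
      g (s x) = ∑ c : ι, (A c).indicator (fun _ => g c.1) x := by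
    by_cases hx : s x = 0
    · rw [hx, hg, Finset.sum_eq_zero]
      intro c _
      refine Set.indicator_of_notMem (fun h => hc0 c ?_) _
      exact (Set.mem_singleton_iff.1 h).symm.trans hx
    · rw [Finset.sum_eq_single (⟨s x, Finset.mem_filter.2 ⟨s.mem_range_self x, hx⟩⟩ : ι)]
      · exact (Set.indicator_of_mem (Set.mem_singleton _) _).symm
      · intro c _ hc
        refine Set.indicator_of_notMem (fun h => hc (Subtype.ext ?_)) _
        exact (Set.mem_singleton_iff.1 h).symm
      · exact fun h => absurd (Finset.mem_univ _) h
  have h1 : ∫ x, (1 - Real.exp (-(s x).toReal)) ∂ν =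
      ∑ c : ι, (1 - Real.exp (-c.1.toReal)) * (ν (A c)).toReal := by
    simp only [hdec (fun c => 1 - Real.exp (-c.toReal)) (by simp)]
    rw [integral_finsetSum]
    · refine Finset.sum_congr rfl fun c _ => ?_
      rw [integral_indicator_const _ (hA c), smul_eq_mul, mul_comm]
      rfl
    · intro c _
      exact (integrable_indicator_iff (hA c)).2 (integrableOn_const (hνA c))
  rw [h1, ← hX.integral_mul_exp_neg_sum hB hA hνA hd hAB hφ]
  -- Finiteness of the counts is what makes `toReal` additive over the level sets.
  have hfin : ∀ᵐ ω ∂μ, ∀ c, pointCount (fun n => X n ω) (A c) ≠ ∞ :=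
    ae_all_iff.2 fun c => hX.ae_pointCount_ne_top (hA c) (hνA c)
  refine integral_congr_ae ?_
  filter_upwards [hfin] with ω hω
  congr 3
  have h2 : ∑' n, s (X n ω) = ∑ c : ι, c.1 * pointCount (fun n => X n ω) (A c) := by
    simp only [fun n => hdec (fun c => c) rfl (X n ω), pointCount, ← ENNReal.tsum_mul_left]
    rw [Summable.tsum_finsetSum fun _ _ => ENNReal.summable]
    refine Finset.sum_congr rfl fun c _ => tsum_congr fun n => ?_
    by_cases h : X n ω ∈ A c <;> simp [h]
  rw [h2, ENNReal.toReal_sum fun c _ => ENNReal.mul_ne_top (hctop c) (hω c)]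
  simp only [ENNReal.toReal_mul]

/-- The Laplace functional of a Poisson point process, jointly with the number of points in a
set on which the test function vanishes. -/
theorem integral_mul_exp_neg_tsum (hX : IsPoissonPointProcess X ν μ) [SigmaFinite ν]
    [IsFiniteMeasure μ]
    {B : Set E} (hB : MeasurableSet B) {φ : ℝ≥0∞ → ℝ} (hφ : Measurable φ)
    {C : ℝ} (hφC : ∀ x, |φ x| ≤ C)
    {f : E → ℝ≥0∞} (hf : Measurable f) (hfB : ∀ x ∈ B, f x = 0) (hfi : ∫⁻ x, f x ∂ν ≠ ∞) :
    ∫ ω, φ (pointCount (fun n => X n ω) B) *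
        Real.exp (-(∑' n, f (X n ω)).toReal) ∂μ =
      (∫ ω, φ (pointCount (fun n => X n ω) B) ∂μ) *
        Real.exp (-∫ x, (1 - Real.exp (-(f x).toReal)) ∂ν) := by
  let s := SimpleFunc.eapprox f
  have hsf (j : ℕ) (x : E) : s j x ≤ f x := by
    rw [← SimpleFunc.iSup_eapprox_apply hf x]
    exact le_iSup (fun n => SimpleFunc.eapprox f n x) j
  have hs_ne_top (j : ℕ) (x : E) : s j x ≠ ∞ := (SimpleFunc.eapprox_lt_top f j x).ne
  have hkey (j : ℕ) := hX.integral_mul_exp_neg_tsum_simpleFunc hB hφ (s j)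
    (fun x hx => le_antisymm ((hsf j x).trans (hfB x hx).le) bot_le) (hs_ne_top j)
    (((lintegral_mono (hsf j)).trans_lt hfi.lt_top).ne)
  -- By Campbell's formula the limiting sum is almost surely finite, so `toReal` is continuous
  -- there.
  have hfin : ∀ᵐ ω ∂μ, ∑' n, f (X n ω) ≠ ∞ := by
    have h := hX.lintegral_tsum_comp hf
    have hm : Measurable fun ω => ∑' n, f (X n ω) :=
      Measurable.tsum fun n => hf.comp (hX.measurable n)
    filter_upwards [ae_lt_top hm (h ▸ hfi)] with ω hω using hω.ne
  have hffin : ∀ᵐ x ∂ν, f x ≠ ∞ := by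
    filter_upwards [ae_lt_top hf hfi] with x hx using hx.ne
  have hlim1 : Filter.Tendsto (fun j => ∫ ω, φ (pointCount (fun n => X n ω) B) *
      Real.exp (-(∑' n, s j (X n ω)).toReal) ∂μ) Filter.atTop
      (nhds (∫ ω, φ (pointCount (fun n => X n ω) B) *
        Real.exp (-(∑' n, f (X n ω)).toReal) ∂μ)) := by
    refine tendsto_integral_of_dominated_convergence (fun _ => C) (fun j => ?_)
      (integrable_const C) (fun j => ?_) ?_
    · have hm : Measurable fun ω => ∑' n, s j (X n ω) :=
        Measurable.tsum fun n => (s j).measurable.comp (hX.measurable n)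
      exact ((hφ.comp (measurable_pointCount hX.measurable hB)).mul
        (Real.measurable_exp.comp hm.ennreal_toReal.neg)).aestronglyMeasurable
    · refine Filter.Eventually.of_forall fun ω => ?_
      rw [Real.norm_eq_abs, abs_mul, Real.abs_exp]
      exact (mul_le_of_le_one_right (abs_nonneg _) (Real.exp_le_one_iff.2 (by simp))).trans
        (hφC _)
    · filter_upwards [hfin] with ω hω
      refine Filter.Tendsto.const_mul _ (Real.continuous_exp.continuousAt.tendsto.comp
        (Filter.Tendsto.neg ((ENNReal.tendsto_toReal hω).comp ?_)))
      -- Monotone convergence for the sum over points, read as an integral against counting measure.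
      have h := lintegral_tendsto_of_tendsto_of_monotone (μ := Measure.count)
        (f := fun j n => s j (X n ω)) (F := fun n => f (X n ω))
        (fun j => (measurable_of_countable _).aemeasurable)
        (Filter.Eventually.of_forall fun n i j hij => SimpleFunc.monotone_eapprox f hij _)
        (Filter.Eventually.of_forall fun n => SimpleFunc.tendsto_eapprox hf _)
      simpa only [lintegral_count] using h
  have hlim2 : Filter.Tendsto (fun j => ∫ x, (1 - Real.exp (-(s j x).toReal)) ∂ν) Filter.atTop
      (nhds (∫ x, (1 - Real.exp (-(f x).toReal)) ∂ν)) := by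
    refine tendsto_integral_of_dominated_convergence (fun x => (f x).toReal) (fun j => ?_)
      (integrable_toReal_of_lintegral_ne_top hf.aemeasurable hfi) (fun j => ?_) ?_
    · exact (measurable_const.sub
        (Real.measurable_exp.comp (s j).measurable.ennreal_toReal.neg)).aestronglyMeasurable
    · filter_upwards [hffin] with x hx
      have h0 : 0 ≤ (s j x).toReal := ENNReal.toReal_nonneg
      have h1 : Real.exp (-(s j x).toReal) ≤ 1 := Real.exp_le_one_iff.2 (by simp)
      rw [Real.norm_eq_abs, abs_of_nonneg (by linarith)]
      -- The domination is `1 - exp (-x) ≤ x`, with `f` integrable.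
      have h2 := Real.add_one_le_exp (-(s j x).toReal)
      have h3 := ENNReal.toReal_mono hx (hsf j x)
      linarith
    · filter_upwards [hffin] with x hx
      exact (Real.continuous_exp.continuousAt.tendsto.comp
        (((ENNReal.tendsto_toReal hx).comp (SimpleFunc.tendsto_eapprox hf x)).neg)).const_sub _
  refine tendsto_nhds_unique hlim1 ?_
  simp only [hkey]
  exact (Real.continuous_exp.continuousAt.tendsto.comp hlim2.neg).const_mul _

end IsPoissonPointProcess

/-! ### Conditional expectations from tail events, and freezing of a random parameter. -/

/-- A nonnegative random variable whose integrals over the events `{b < R}` agree with those of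
`g (R)` has conditional expectation `g (R)` given the positive random variable `R`. -/
theorem condExp_comap_ae_eq_of_setIntegral_Ioi {Ω : Type*} [MeasurableSpace Ω] {μ : Measure Ω}
    [IsFiniteMeasure μ] {R : Ω → ℝ} (hR : Measurable R) (hR0 : ∀ᵐ ω ∂μ, 0 < R ω)
    {F : Ω → ℝ} (hF : Integrable F μ) (hF0 : 0 ≤ᵐ[μ] F) {g : ℝ → ℝ} (hg : Measurable g)
    (hgi : Integrable (fun ω => g (R ω)) μ) (hg0 : ∀ᵐ ω ∂μ, 0 ≤ g (R ω))
    (h : ∀ b, 0 ≤ b → ∫ ω in R ⁻¹' Set.Ioi b, F ω ∂μ = ∫ ω in R ⁻¹' Set.Ioi b, g (R ω) ∂μ) :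
    μ[F | MeasurableSpace.comap R inferInstance] =ᵐ[μ] fun ω => g (R ω) := by
  have hle (b : ℝ) :
      ∫ ω in R ⁻¹' Set.Iic b, F ω ∂μ = ∫ ω in R ⁻¹' Set.Iic b, g (R ω) ∂μ := by
    rcases lt_or_ge b 0 with hb | hb
    · have h0 : μ.restrict (R ⁻¹' Set.Iic b) = 0 := by
        rw [Measure.restrict_eq_zero]
        refine measure_mono_null (fun ω hω => ?_) hR0
        exact (lt_of_le_of_lt hω hb).not_gt
      rw [h0]
      simp
    · have hun : R ⁻¹' Set.Iic b = (R ⁻¹' Set.Ioi b)ᶜ := by ext; simp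
      have htot : ∫ ω, F ω ∂μ = ∫ ω, g (R ω) ∂μ := by
        have h1 : R ⁻¹' Set.Ioi 0 =ᵐ[μ] Set.univ := by
          filter_upwards [hR0] with ω hω
          exact propext ⟨fun _ => trivial, fun _ => hω⟩
        have h2 := h 0 le_rfl
        rwa [setIntegral_congr_set h1, setIntegral_congr_set h1, setIntegral_univ,
          setIntegral_univ] at h2
      rw [hun, setIntegral_compl (hR measurableSet_Ioi) hF,
        setIntegral_compl (hR measurableSet_Ioi) hgi, htot, h b hb]
  -- Weighting `μ` by a nonnegative density and pushing forward along `R` gives a finite measure on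
  -- `ℝ`. Agreement on the half-lines `Iic b` therefore gives agreement on all Borel sets, that is,
  -- on all events of the σ-algebra of `R`.
  have key (G : Ω → ℝ) (hG : Integrable G μ) (hG0 : 0 ≤ᵐ[μ] G) {B : Set ℝ}
      (hB : MeasurableSet B) :
      (μ.withDensity fun ω => ENNReal.ofReal (G ω)).map R B =
        ENNReal.ofReal (∫ ω in R ⁻¹' B, G ω ∂μ) := by
    rw [Measure.map_apply hR hB, withDensity_apply _ (hR hB),
      ofReal_integral_eq_lintegral_ofReal hG.integrableOn (ae_restrict_of_ae hG0)]
  have hfin : IsFiniteMeasure ((μ.withDensity fun ω => ENNReal.ofReal (F ω)).map R) :=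
    ⟨by rw [key F hF hF0 MeasurableSet.univ]; exact ENNReal.ofReal_lt_top⟩
  have heq : (μ.withDensity fun ω => ENNReal.ofReal (F ω)).map R =
      (μ.withDensity fun ω => ENNReal.ofReal (g (R ω))).map R := by
    refine Measure.ext_of_Iic _ _ fun b => ?_
    rw [key F hF hF0 measurableSet_Iic, key _ hgi hg0 measurableSet_Iic, hle b]
  refine (ae_eq_condExp_of_forall_setIntegral_eq hR.comap_le hF
    (fun s _ _ => hgi.integrableOn) ?_ ?_).symm
  · rintro s ⟨B, hB, rfl⟩ -
    have h1 := congrArg (fun m => m B) heq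
    beta_reduce at h1
    rw [key F hF hF0 hB, key _ hgi hg0 hB, ENNReal.ofReal_eq_ofReal_iff
      (setIntegral_nonneg_of_ae hF0) (setIntegral_nonneg_of_ae hg0)] at h1
    exact h1.symm
  · exact (hg.comp (comap_measurable R)).aestronglyMeasurable

/-- The point of the grid cell `(b + k * δ, b + (k + 1) * δ]`, `δ = 1 / (j + 1)`, containing
`r`, at relative position `θ`. -/
noncomputable def gridPoint (θ b : ℝ) (j : ℕ) (r : ℝ) : ℝ :=
  b + ((⌈(r - b) * (j + 1)⌉₊ : ℝ) - 1 + θ) / (j + 1)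

theorem measurable_gridPoint (θ b : ℝ) (j : ℕ) : Measurable (gridPoint θ b j) := by
  unfold gridPoint
  have h : Measurable fun r : ℝ => (⌈(r - b) * (j + 1)⌉₊ : ℝ) :=
    measurable_from_nat.comp (Nat.measurable_ceil.comp (by fun_prop))
  fun_prop

theorem gridPoint_eq_of_mem {θ b r : ℝ} {j k : ℕ}
    (hr : r ∈ Set.Ioc (b + k / (j + 1 : ℝ)) (b + (k + 1 : ℕ) / (j + 1 : ℝ))) :
    gridPoint θ b j r = b + k / (j + 1 : ℝ) +
      θ * (b + (k + 1 : ℕ) / (j + 1 : ℝ) - (b + k / (j + 1 : ℝ))) := by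
  have hj : (0 : ℝ) < j + 1 := by positivity
  have h1 : (k : ℝ) < (r - b) * (j + 1) := by
    rw [← div_lt_iff₀ hj]; linarith [hr.1]
  have h2 : (r - b) * (j + 1) ≤ (k + 1 : ℕ) := by
    rw [← le_div_iff₀ hj]; linarith [hr.2]
  have h3 : ⌈(r - b) * (j + 1)⌉₊ = k + 1 := by
    rw [Nat.ceil_eq_iff (by omega)]
    simpa only [Nat.add_sub_cancel] using And.intro h1 h2
  rw [gridPoint, h3]
  push_cast
  field_simp
  ring

theorem abs_gridPoint_sub_le {θ b r : ℝ} (hθ : θ ∈ Set.Icc (0 : ℝ) 1) (hr : b < r) (j : ℕ) :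
    |gridPoint θ b j r - r| ≤ 1 / (j + 1) := by
  have hj : (0 : ℝ) < j + 1 := by positivity
  have h1 := Nat.le_ceil ((r - b) * (j + 1))
  have h2 := Nat.ceil_lt_add_one (a := (r - b) * (j + 1)) (by nlinarith)
  have h3 : gridPoint θ b j r - r =
      ((⌈(r - b) * (j + 1)⌉₊ : ℝ) - (r - b) * (j + 1) - 1 + θ) / (j + 1) := by
    unfold gridPoint
    field_simp
    ring
  rw [h3, abs_div, abs_of_pos hj]
  gcongr
  rw [abs_le]
  constructor <;> linarith [hθ.1, hθ.2]

theorem le_gridPoint_one {b r : ℝ} (j : ℕ) : r ≤ gridPoint 1 b j r := by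
  have hj : (0 : ℝ) < j + 1 := by positivity
  have h1 := Nat.le_ceil ((r - b) * (j + 1))
  unfold gridPoint
  rw [← sub_le_iff_le_add', le_div_iff₀ hj]
  linarith

theorem gridPoint_zero_lt {b r : ℝ} (hr : b < r) (j : ℕ) : gridPoint 0 b j r < r := by
  have hj : (0 : ℝ) < j + 1 := by positivity
  have h2 := Nat.ceil_lt_add_one (a := (r - b) * (j + 1)) (by nlinarith)
  unfold gridPoint
  rw [← lt_sub_iff_add_lt', div_lt_iff₀ hj]
  linarith

/-- If two bounded families of random variables have equal integrals over all events
`{s < R ≤ a}` when their parameter is frozen at an end of `(s, a]`, then the limits obtained by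
letting the parameter tend to `R` from the corresponding side have equal integrals over
`{b < R}`. -/
theorem setIntegral_Ioi_eq_of_frozen {Ω : Type*} [MeasurableSpace Ω] {μ : Measure Ω}
    [IsFiniteMeasure μ] {R : Ω → ℝ} (hR : Measurable R) {W V : ℝ → Ω → ℝ} {W' V' : Ω → ℝ}
    (hW : Measurable fun p : ℝ × Ω => W p.1 p.2) (hV : Measurable fun p : ℝ × Ω => V p.1 p.2)
    {C : ℝ} (hWC : ∀ a ω, |W a ω| ≤ C) (hVC : ∀ a ω, |V a ω| ≤ C)
    {θ : ℝ} (hθ : θ ∈ Set.Icc (0 : ℝ) 1)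
    (hWV : ∀ s a, 0 ≤ s → s < a → ∫ ω in R ⁻¹' Set.Ioc s a, W (s + θ * (a - s)) ω ∂μ =
      ∫ ω in R ⁻¹' Set.Ioc s a, V (s + θ * (a - s)) ω ∂μ)
    (hlim : ∀ᵐ ω ∂μ, ∀ u : ℕ → ℝ, Filter.Tendsto u Filter.atTop (nhds (R ω)) →
      (θ = 1 → ∀ j, R ω ≤ u j) → (θ = 0 → ∀ j, u j < R ω) →
      Filter.Tendsto (fun j => W (u j) ω) Filter.atTop (nhds (W' ω)) ∧
      Filter.Tendsto (fun j => V (u j) ω) Filter.atTop (nhds (V' ω)))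
    {b : ℝ} (hb : 0 ≤ b) :
    ∫ ω in R ⁻¹' Set.Ioi b, W' ω ∂μ = ∫ ω in R ⁻¹' Set.Ioi b, V' ω ∂μ := by
  have hmeas {U : ℝ → Ω → ℝ} (hU : Measurable fun p : ℝ × Ω => U p.1 p.2) (j : ℕ) :
      Measurable fun ω => U (gridPoint θ b j (R ω)) ω :=
    hU.comp (((measurable_gridPoint θ b j).comp hR).prodMk measurable_id)
  have hint {U : ℝ → Ω → ℝ} (hU : Measurable fun p : ℝ × Ω => U p.1 p.2)
      (hUC : ∀ a ω, |U a ω| ≤ C) (j : ℕ) :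
      Integrable (fun ω => U (gridPoint θ b j (R ω)) ω) μ :=
    (integrable_const C).mono' (hmeas hU j).aestronglyMeasurable
      (Filter.Eventually.of_forall fun ω => hUC _ _)
  -- On each grid cell the grid point of `R` is constant, so the frozen hypothesis applies cell by
  -- cell.
  have hstep (j : ℕ) : ∫ ω in R ⁻¹' Set.Ioi b, W (gridPoint θ b j (R ω)) ω ∂μ =
      ∫ ω in R ⁻¹' Set.Ioi b, V (gridPoint θ b j (R ω)) ω ∂μ := by
    let a : ℕ → ℝ := fun k => b + k / (j + 1 : ℝ)
    have hmono : StrictMono a := fun k l hkl => by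
      have : (k : ℝ) < l := by exact_mod_cast hkl
      simp only [a]
      gcongr
    have hun : R ⁻¹' Set.Ioi b = ⋃ k : ℕ, R ⁻¹' Set.Ioc (a k) (a (k + 1)) := by
      rw [← Set.preimage_iUnion]
      congr 1
      ext r
      simp only [Set.mem_Ioi, Set.mem_iUnion]
      constructor
      · intro hr
        have hj : (0 : ℝ) < j + 1 := by positivity
        have hp : 0 < ⌈(r - b) * (j + 1)⌉₊ := Nat.ceil_pos.2 (by nlinarith)
        obtain ⟨k, hk⟩ := Nat.exists_eq_succ_of_ne_zero hp.ne'
        have h2 := (Nat.ceil_eq_iff (by omega)).1 hk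
        simp only [Nat.succ_eq_add_one, Nat.add_sub_cancel] at h2
        refine ⟨k, ?_, ?_⟩
        · simp only [a]
          rw [← lt_sub_iff_add_lt', div_lt_iff₀ hj]
          exact h2.1
        · simp only [a]
          rw [← sub_le_iff_le_add', le_div_iff₀ hj]
          exact h2.2
      · rintro ⟨k, hk⟩
        have : a 0 ≤ a k := hmono.monotone (Nat.zero_le k)
        have h0 : a 0 = b := by simp [a]
        exact h0 ▸ this.trans_lt hk.1
    have hdis : Pairwise fun k l : ℕ =>
        Disjoint (R ⁻¹' Set.Ioc (a k) (a (k + 1))) (R ⁻¹' Set.Ioc (a l) (a (l + 1))) :=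
      fun k l hkl => (hmono.monotone.pairwise_disjoint_on_Ioc_succ hkl).preimage R
    rw [hun, integral_iUnion (fun k => hR measurableSet_Ioc) hdis (hint hW hWC j).integrableOn,
      integral_iUnion (fun k => hR measurableSet_Ioc) hdis (hint hV hVC j).integrableOn]
    refine tsum_congr fun k => ?_
    have hcell {U : ℝ → Ω → ℝ} :
        ∫ ω in R ⁻¹' Set.Ioc (a k) (a (k + 1)), U (gridPoint θ b j (R ω)) ω ∂μ =
        ∫ ω in R ⁻¹' Set.Ioc (a k) (a (k + 1)), U (a k + θ * (a (k + 1) - a k)) ω ∂μ :=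
      setIntegral_congr_fun (hR measurableSet_Ioc) fun ω hω => by
        simp only [gridPoint_eq_of_mem (θ := θ) (show R ω ∈ Set.Ioc _ _ from hω), a]
    rw [hcell, hcell]
    refine hWV _ _ ?_ (hmono (Nat.lt_succ_self k))
    simp only [a]
    positivity
  have hu {ω : Ω} (hω : b < R ω) :
      Filter.Tendsto (fun j => gridPoint θ b j (R ω)) Filter.atTop (nhds (R ω)) := by
    rw [tendsto_iff_dist_tendsto_zero]
    refine squeeze_zero (fun _ => dist_nonneg) (fun j => ?_) tendsto_one_div_add_atTop_nhds_zero_nat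
    exact abs_gridPoint_sub_le hθ hω j
  have hlim' : ∀ᵐ ω ∂(μ.restrict (R ⁻¹' Set.Ioi b)),
      Filter.Tendsto (fun j => W (gridPoint θ b j (R ω)) ω) Filter.atTop (nhds (W' ω)) ∧
      Filter.Tendsto (fun j => V (gridPoint θ b j (R ω)) ω) Filter.atTop (nhds (V' ω)) := by
    filter_upwards [ae_restrict_of_ae hlim, ae_restrict_mem (hR measurableSet_Ioi)] with ω h1 h2
    refine h1 _ (hu h2) ?_ ?_
    · rintro rfl j
      exact le_gridPoint_one j
    · rintro rfl j
      exact gridPoint_zero_lt h2 j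
  refine tendsto_nhds_unique (f := fun j : ℕ =>
    ∫ ω in R ⁻¹' Set.Ioi b, W (gridPoint θ b j (R ω)) ω ∂μ) (l := Filter.atTop) ?_ ?_
  · exact tendsto_integral_of_dominated_convergence (fun _ => C)
      (fun j => (hmeas hW j).aestronglyMeasurable) (integrable_const C)
      (fun j => Filter.Eventually.of_forall fun ω => hWC _ _) (hlim'.mono fun ω h => h.1)
  · simp only [hstep]
    exact tendsto_integral_of_dominated_convergence (fun _ => C)
      (fun j => (hmeas hV j).aestronglyMeasurable) (integrable_const C)
      (fun j => Filter.Eventually.of_forall fun ω => hVC _ _) (hlim'.mono fun ω h => h.2)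

/-! ### Unit exponential gains and averaging over them. -/

theorem toReal_tsum_ofReal {ι : Type*} {a : ι → ℝ} (ha : ∀ n, 0 ≤ a n) :
    (∑' n, ENNReal.ofReal (a n)).toReal = ∑' n, a n := by
  rw [ENNReal.tsum_toReal_eq fun _ => ENNReal.ofReal_ne_top]
  exact tsum_congr fun n => ENNReal.toReal_ofReal (ha n)

theorem summable_iff_tsum_ofReal_ne_top {ι : Type*} {a : ι → ℝ} (ha : ∀ n, 0 ≤ a n) :
    Summable a ↔ ∑' n, ENNReal.ofReal (a n) ≠ ∞ := by
  refine ⟨fun h => h.tsum_ofReal_ne_top, fun h => ?_⟩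
  simpa only [ENNReal.toReal_ofReal (ha _)] using ENNReal.summable_toReal h

theorem measurable_gammaPDF (a r : ℝ) : Measurable (gammaPDF a r) :=
  (measurable_gammaPDFReal a r).ennreal_ofReal

theorem ae_nonneg_expMeasure_one : ∀ᵐ x ∂(expMeasure 1), 0 ≤ x := by
  rw [expMeasure, gammaMeasure, ae_withDensity_iff (measurable_gammaPDF 1 1)]
  refine Filter.Eventually.of_forall fun x hx => ?_
  by_contra h
  exact hx (gammaPDF_of_neg (not_le.1 h))

theorem integral_exp_neg_mul_expMeasure_one {t : ℝ} (ht : 0 ≤ t) :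
    ∫ x, Real.exp (-(t * x)) ∂(expMeasure 1) = 1 / (1 + t) := by
  rw [expMeasure, gammaMeasure, integral_withDensity_eq_integral_toReal_smul
    (measurable_gammaPDF 1 1)
    (Filter.Eventually.of_forall fun _ => ENNReal.ofReal_lt_top)]
  have h1 : ∫ x, (gammaPDF 1 1 x).toReal • Real.exp (-(t * x)) =
      ∫ x in Set.Ici 0, Real.exp (-(1 + t) * x) := by
    rw [← integral_indicator measurableSet_Ici]
    refine integral_congr_ae (Filter.Eventually.of_forall fun x => ?_)
    by_cases hx : 0 ≤ x
    · simp only [gammaPDF_of_nonneg hx, Set.indicator_of_mem (Set.mem_Ici.2 hx), smul_eq_mul]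
      rw [ENNReal.toReal_ofReal (by positivity)]
      simp only [Real.one_rpow, Real.Gamma_one, sub_self, Real.rpow_zero, one_mul, div_one,
        ← Real.exp_add]
      congr 1
      ring
    · simp only [gammaPDF_of_neg (not_le.1 hx)]
      rw [Set.indicator_of_notMem (by simpa using hx)]
      simp
  rw [h1, integral_Ici_eq_integral_Ioi, integral_exp_mul_Ioi (by linarith)]
  simp only [mul_zero, Real.exp_zero]
  rw [neg_div_neg_eq]

theorem lintegral_ofReal_expMeasure_one : ∫⁻ x, ENNReal.ofReal x ∂(expMeasure 1) = 1 := by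
  rw [expMeasure, gammaMeasure, lintegral_withDensity_eq_lintegral_mul _
    (measurable_gammaPDF 1 1) (by fun_prop),
    -- Multiplying the unit exponential density by `x` gives the Gamma density of shape `2`, which
    -- has total mass `1`.
    ← lintegral_gammaPDF_eq_one (a := 2) (r := 1) two_pos one_pos]
  refine lintegral_congr fun x => ?_
  rw [Pi.mul_apply]
  rcases lt_or_ge x 0 with hx | hx
  · rw [gammaPDF_of_neg hx, gammaPDF_of_neg hx, zero_mul]
  · rw [gammaPDF_of_nonneg hx, gammaPDF_of_nonneg hx, ← ENNReal.ofReal_mul (by positivity)]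
    congr 1
    have h2 : Real.Gamma 2 = 1 := Real.Gamma_two
    simp only [Real.one_rpow, Real.Gamma_one, h2, sub_self, Real.rpow_zero]
    norm_num
    ring

section Gains

variable {Ω : Type*} [MeasurableSpace Ω] {μ : Measure Ω}
  {h : ℕ → Ω → ℝ}

theorem ae_nonneg_of_map_eq_expMeasure_one (hh_meas : ∀ n, Measurable (h n))
    (hh_law : ∀ n, μ.map (h n) = expMeasure 1) :
    ∀ᵐ ω ∂μ, ∀ n, 0 ≤ h n ω := by
  refine ae_all_iff.2 fun n => ae_of_ae_map (hh_meas n).aemeasurable ?_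
  rw [hh_law n]
  exact ae_nonneg_expMeasure_one

theorem ae_tsum_ofReal_mul_ne_top (hh_meas : ∀ n, Measurable (h n))
    (hh_law : ∀ n, μ.map (h n) = expMeasure 1)
    {t : ℕ → ℝ} (ht : ∀ n, 0 ≤ t n) (hts : Summable t) :
    ∀ᵐ ω ∂μ, ∑' n, ENNReal.ofReal (t n * h n ω) ≠ ∞ := by
  have hm (n : ℕ) : Measurable fun ω => ENNReal.ofReal (t n * h n ω) :=
    ((hh_meas n).const_mul _).ennreal_ofReal
  have h1 : ∫⁻ ω, ∑' n, ENNReal.ofReal (t n * h n ω) ∂μ ≠ ∞ := by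
    rw [lintegral_tsum fun n => (hm n).aemeasurable]
    have h2 (n : ℕ) : ∫⁻ ω, ENNReal.ofReal (t n * h n ω) ∂μ = ENNReal.ofReal (t n) := by
      simp only [ENNReal.ofReal_mul (ht n)]
      rw [lintegral_const_mul _ (hh_meas n).ennreal_ofReal,
        ← lintegral_map (f := fun x => ENNReal.ofReal x) (by fun_prop) (hh_meas n), hh_law n,
        lintegral_ofReal_expMeasure_one, mul_one]
    simp only [h2]
    exact hts.tsum_ofReal_ne_top
  filter_upwards [ae_lt_top (Measurable.tsum hm) h1] with ω hω using hω.ne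

/-- Independence gives the product over finitely many gains, and dominated convergence passes to
infinitely many. The product is written as the exponential of a sum so that the Laplace functional
of the points can be applied to it. -/
theorem integral_exp_neg_tsum_mul [IsProbabilityMeasure μ]
    (hh_meas : ∀ n, Measurable (h n))
    (hh_law : ∀ n, μ.map (h n) = expMeasure 1)
    (hh_indep : iIndepFun h μ)
    {t : ℕ → ℝ} (ht : ∀ n, 0 ≤ t n) (hts : Summable t) :
    ∫ ω, Real.exp (-(∑' n, ENNReal.ofReal (t n * h n ω)).toReal) ∂μ =
      Real.exp (-∑' n, Real.log (1 + t n)) := by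
  have hpart (N : ℕ) : ∫ ω, Real.exp (-∑ n ∈ Finset.range N, t n * h n ω) ∂μ =
      Real.exp (-∑ n ∈ Finset.range N, Real.log (1 + t n)) := by
    have h1 := (hh_indep.precomp (g := fun n : Fin N => (n : ℕ))
      Fin.val_injective).integral_fun_prod_comp (f := fun (n : Fin N) x => Real.exp (-(t n * x)))
      (fun n => (hh_meas n).aemeasurable)
      (fun n => (by fun_prop : Measurable fun x : ℝ => Real.exp (-(t n * x))).aestronglyMeasurable)
    have h2 (n : ℕ) : ∫ ω, Real.exp (-(t n * h n ω)) ∂μ = Real.exp (-Real.log (1 + t n)) := by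
      have h3 : ∫ x, Real.exp (-(t n * x)) ∂(μ.map (h n)) = _ :=
        integral_map (hh_meas n).aemeasurable
          (by fun_prop : Measurable fun x : ℝ => Real.exp (-(t n * x))).aestronglyMeasurable
      rw [← h3, hh_law n, integral_exp_neg_mul_expMeasure_one (ht n), Real.exp_neg,
        Real.exp_log (by linarith [ht n]), one_div]
    simp only [h2, ← Real.exp_sum, Finset.sum_neg_distrib] at h1
    simpa only [Finset.sum_range] using h1
  have hnn := ae_nonneg_of_map_eq_expMeasure_one hh_meas hh_law
  have hlog (n : ℕ) : 0 ≤ Real.log (1 + t n) := Real.log_nonneg (by linarith [ht n])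
  have hlogs : Summable fun n => Real.log (1 + t n) :=
    hts.of_nonneg_of_le hlog fun n => by
      have := Real.log_le_sub_one_of_pos (x := 1 + t n) (by linarith [ht n])
      linarith
  have hl1 : Filter.Tendsto (fun N : ℕ => ∫ ω, Real.exp (-∑ n ∈ Finset.range N, t n * h n ω) ∂μ)
      Filter.atTop
      (nhds (∫ ω, Real.exp (-(∑' n, ENNReal.ofReal (t n * h n ω)).toReal) ∂μ)) := by
    refine tendsto_integral_of_dominated_convergence (fun _ => 1) (fun N => ?_)
      (integrable_const 1) (fun N => ?_) ?_
    · exact (by fun_prop : Measurable fun ω =>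
        Real.exp (-∑ n ∈ Finset.range N, t n * h n ω)).aestronglyMeasurable
    · filter_upwards [hnn] with ω hω
      rw [Real.norm_eq_abs, Real.abs_exp, Real.exp_le_one_iff, neg_nonpos]
      exact Finset.sum_nonneg fun n _ => mul_nonneg (ht n) (hω n)
    · filter_upwards [hnn, ae_tsum_ofReal_mul_ne_top hh_meas hh_law ht hts] with ω hω hs
      have hp (n : ℕ) : 0 ≤ t n * h n ω := mul_nonneg (ht n) (hω n)
      rw [toReal_tsum_ofReal hp]
      exact Real.continuous_exp.continuousAt.tendsto.comp
        ((summable_iff_tsum_ofReal_ne_top hp).2 hs).hasSum.tendsto_sum_nat.neg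
  refine tendsto_nhds_unique hl1 ?_
  simp only [hpart]
  exact Real.continuous_exp.continuousAt.tendsto.comp hlogs.hasSum.tendsto_sum_nat.neg

/-- Averaging over independent exponential gains, given the random environment `Y`. -/
theorem setIntegral_exp_neg_tsum_mul [IsProbabilityMeasure μ]
    (hh_meas : ∀ n, Measurable (h n))
    (hh_law : ∀ n, μ.map (h n) = expMeasure 1)
    (hh_indep : iIndepFun h μ)
    {S : Type*} [MeasurableSpace S] {Y : Ω → S} (hY : Measurable Y)
    (hYh : IndepFun Y (fun ω n => h n ω) μ) {t : ℕ → S → ℝ} (htm : ∀ n, Measurable (t n))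
    (ht : ∀ n y, 0 ≤ t n y) (hts : ∀ᵐ ω ∂μ, Summable fun n => t n (Y ω)) :
    (∀ᵐ ω ∂μ, Summable fun n => t n (Y ω) * h n ω) ∧
    ∀ B : Set S, MeasurableSet B →
      ∫ ω in Y ⁻¹' B, Real.exp (-∑' n, t n (Y ω) * h n ω) ∂μ =
      ∫ ω in Y ⁻¹' B, Real.exp (-∑' n, Real.log (1 + t n (Y ω))) ∂μ := by
  have hnn := ae_nonneg_of_map_eq_expMeasure_one hh_meas hh_law
  have hhm : Measurable fun ω n => h n ω := measurable_pi_lambda _ hh_meas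
  have hpair : Measurable fun ω => (Y ω, fun n => h n ω) := hY.prodMk hhm
  let I : S × (ℕ → ℝ) → ℝ≥0∞ := fun p => ∑' n, ENNReal.ofReal (t n p.1 * p.2 n)
  have hI : Measurable I := Measurable.tsum fun n =>
    (((htm n).comp measurable_fst).mul ((measurable_pi_apply n).comp measurable_snd)).ennreal_ofReal
  have hmap := (indepFun_iff_map_prod_eq_prod_map_map hY.aemeasurable hhm.aemeasurable).1 hYh
  have : IsProbabilityMeasure (μ.map Y) := Measure.isProbabilityMeasure_map hY.aemeasurable
  have : IsProbabilityMeasure (μ.map fun ω n => h n ω) :=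
    Measure.isProbabilityMeasure_map hhm.aemeasurable
  -- Summability of nonnegative terms is finiteness of an `ℝ≥0∞`-valued sum, hence a measurable
  -- condition that transfers to the law of `Y`.
  have htY : ∀ᵐ y ∂(μ.map Y), Summable fun n => t n y := by
    have hms : MeasurableSet {y | Summable fun n => t n y} := by
      simp only [summable_iff_tsum_ofReal_ne_top fun n => ht n _]
      exact (Measurable.tsum fun n => (htm n).ennreal_ofReal)
        (measurableSet_singleton ∞).compl
    exact (ae_map_iff hY.aemeasurable hms).2 hts
  have hfin : ∀ᵐ ω ∂μ, I (Y ω, fun n => h n ω) ≠ ∞ := by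
    have hms : MeasurableSet {p | I p ≠ ∞} := hI (measurableSet_singleton ∞).compl
    refine ae_of_ae_map (p := fun p => I p ≠ ∞) hpair.aemeasurable ?_
    rw [hmap, Measure.ae_prod_iff_ae_ae hms]
    filter_upwards [htY] with y hy
    refine (ae_map_iff hhm.aemeasurable (measurable_prodMk_left hms)).2 ?_
    exact ae_tsum_ofReal_mul_ne_top hh_meas hh_law (fun n => ht n y) hy
  constructor
  · filter_upwards [hfin, hnn] with ω h1 h2
    exact (summable_iff_tsum_ofReal_ne_top fun n => mul_nonneg (ht n _) (h2 n)).2 h1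
  intro B hB
  have hG : Measurable fun p : S × (ℕ → ℝ) =>
      B.indicator (fun _ => (1 : ℝ)) p.1 * Real.exp (-(I p).toReal) :=
    ((measurable_const.indicator hB).comp measurable_fst).mul
      (Real.measurable_exp.comp hI.ennreal_toReal.neg)
  have hGi : Integrable (fun p : S × (ℕ → ℝ) =>
      B.indicator (fun _ => (1 : ℝ)) p.1 * Real.exp (-(I p).toReal))
      ((μ.map Y).prod (μ.map fun ω n => h n ω)) := by
    refine (integrable_const (1 : ℝ)).mono' hG.aestronglyMeasurable
      (Filter.Eventually.of_forall fun p => ?_)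
    rw [Real.norm_eq_abs, abs_mul, Real.abs_exp]
    refine mul_le_one₀ ?_ (Real.exp_pos _).le (Real.exp_le_one_iff.2 (by simp))
    by_cases hp : p.1 ∈ B <;> simp [hp]
  have hind (G : Ω → ℝ) : ∫ ω in Y ⁻¹' B, G ω ∂μ =
      ∫ ω, B.indicator (fun _ => (1 : ℝ)) (Y ω) * G ω ∂μ := by
    rw [← integral_indicator (hY hB)]
    refine integral_congr_ae (Filter.Eventually.of_forall fun ω => ?_)
    by_cases hp : Y ω ∈ B <;> simp [hp]
  rw [hind, hind]
  have hL : ∫ ω, B.indicator (fun _ => (1 : ℝ)) (Y ω) *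
      Real.exp (-∑' n, t n (Y ω) * h n ω) ∂μ =
      ∫ ω, B.indicator (fun _ => (1 : ℝ)) (Y ω) *
        Real.exp (-(I (Y ω, fun n => h n ω)).toReal) ∂μ := by
    refine integral_congr_ae ?_
    filter_upwards [hnn] with ω hω
    simp only [I]
    rw [toReal_tsum_ofReal fun n => mul_nonneg (ht n _) (hω n)]
  rw [hL, ← integral_map (f := fun p : S × (ℕ → ℝ) =>
    B.indicator (fun _ => (1 : ℝ)) p.1 * Real.exp (-(I p).toReal)) hpair.aemeasurable
    hG.aestronglyMeasurable, hmap, integral_prod _ hGi]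
  have hR : Measurable fun y => B.indicator (fun _ => (1 : ℝ)) y *
      Real.exp (-(∑' n, ENNReal.ofReal (Real.log (1 + t n y))).toReal) :=
    (measurable_const.indicator hB).mul (Real.measurable_exp.comp
      (Measurable.tsum fun n =>
        (Real.measurable_log.comp (measurable_const.add (htm n))).ennreal_ofReal).ennreal_toReal.neg)
  have hR2 (y : S) : (∑' n, ENNReal.ofReal (Real.log (1 + t n y))).toReal =
      ∑' n, Real.log (1 + t n y) :=
    toReal_tsum_ofReal fun n => Real.log_nonneg (by linarith [ht n y])
  simp only [hR2] at hR
  rw [← integral_map (f := fun y => B.indicator (fun _ => (1 : ℝ)) y *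
      Real.exp (-∑' n, Real.log (1 + t n y))) hY.aemeasurable hR.aestronglyMeasurable]
  refine integral_congr_ae ?_
  filter_upwards [htY] with y hy
  rw [integral_const_mul, integral_map (f := fun a => Real.exp (-(I (y, a)).toReal))
    hhm.aemeasurable (Real.measurable_exp.comp
      (hI.comp measurable_prodMk_left).ennreal_toReal.neg).aestronglyMeasurable]
  congr 1
  exact integral_exp_neg_tsum_mul hh_meas hh_law hh_indep (fun n => ht n y) hy

end Gains

/-! ### Planar integrals of radial functions and the constant `ϑ`. -/

theorem integrable_comp_dist_iff {G : ℝ → ℝ} (u : EuclideanSpace ℝ (Fin 2)) :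
    Integrable (fun x => G (dist u x)) ↔ IntegrableOn (fun y => y * G y) (Set.Ioi 0) := by
  have h := integrable_fun_norm_addHaar (E := EuclideanSpace ℝ (Fin 2)) volume (f := G)
  simp only [finrank_euclideanSpace, Fintype.card_fin, Nat.add_one_sub_one, pow_one,
    smul_eq_mul] at h
  rw [← h]
  simp only [dist_eq_norm]
  exact integrable_comp_sub_left (fun x => G ‖x‖) u

theorem integral_comp_dist (G : ℝ → ℝ) (u : EuclideanSpace ℝ (Fin 2)) :
    ∫ x, G (dist u x) = 2 * Real.pi * ∫ y in Set.Ioi 0, y * G y := by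
  have h := integral_fun_norm_addHaar (E := EuclideanSpace ℝ (Fin 2)) volume G
  rw [← integral_sub_left_eq_self (fun x => G ‖x‖) volume u] at h
  simp only [dist_eq_norm]
  rw [h]
  simp only [finrank_euclideanSpace, Fintype.card_fin, Nat.add_one_sub_one, pow_one,
    smul_eq_mul, measureReal_def, EuclideanSpace.volume_ball_fin_two]
  simp [Real.pi_pos.le, mul_assoc]

/-- In polar coordinates the integrand is `y ^ (1 - η)` on `(a, ∞)`; this is where `η > 2` is
needed. -/
theorem integrable_dist_rpow_far (u : EuclideanSpace ℝ (Fin 2)) {a η : ℝ} (ha : 0 < a)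
    (hη : 2 < η) :
    Integrable (fun x => if a < dist u x then dist u x ^ (-η) else 0) := by
  refine (integrable_comp_dist_iff (G := fun r => if a < r then r ^ (-η) else 0) u).2 ?_
  have h1 := (integrableOn_Ioi_rpow_of_lt (a := 1 - η) (by linarith) ha)
  refine (((integrable_indicator_iff measurableSet_Ioi).2 h1).integrableOn).congr_fun ?_
    measurableSet_Ioi
  intro y (hy : 0 < y)
  by_cases h : a < y
  · simp only [Set.indicator_of_mem (Set.mem_Ioi.2 h), if_pos h]
    rw [sub_eq_add_neg, Real.rpow_add hy, Real.rpow_one]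
  · simp [h]

/-- The exponent `log (1 + T (a / r) ^ η)` picked up by averaging out the gain of an interferer
at distance `r > a`. -/
noncomputable def logAttenuation (T η a r : ℝ) : ℝ :=
  if a < r then Real.log (1 + T * a ^ η * r ^ (-η)) else 0

theorem measurable_logAttenuation (T η : ℝ) :
    Measurable fun p : ℝ × ℝ => logAttenuation T η p.1 p.2 := by
  unfold logAttenuation
  refine Measurable.ite (measurableSet_lt measurable_fst measurable_snd) ?_ measurable_const
  fun_prop

theorem logAttenuation_nonneg {T a : ℝ} (hT : 0 < T) (ha : 0 ≤ a) (η r : ℝ) :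
    0 ≤ logAttenuation T η a r := by
  unfold logAttenuation
  split_ifs with h
  · have hr : 0 ≤ r := ha.trans h.le
    exact Real.log_nonneg (by linarith [show 0 ≤ T * a ^ η * r ^ (-η) by positivity])
  · rfl

theorem logAttenuation_le {T a : ℝ} (hT : 0 < T) (ha : 0 ≤ a) (η r : ℝ) :
    logAttenuation T η a r ≤ T * a ^ η * (if a < r then r ^ (-η) else 0) := by
  unfold logAttenuation
  split_ifs with h
  · have hr : 0 ≤ r := ha.trans h.le
    have := Real.log_le_sub_one_of_pos (x := 1 + T * a ^ η * r ^ (-η)) (by positivity)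
    linarith
  · simp

theorem exp_neg_logAttenuation {T a : ℝ} (hT : 0 < T) (ha : 0 ≤ a) (η r : ℝ) :
    1 - Real.exp (-logAttenuation T η a r) =
      if a < r then 1 - 1 / (1 + T * a ^ η * r ^ (-η)) else 0 := by
  unfold logAttenuation
  split_ifs with h
  · have hr : 0 ≤ r := ha.trans h.le
    rw [Real.exp_neg, Real.exp_log (by positivity), one_div]
  · simp

theorem lintegral_logAttenuation_ne_top (u : EuclideanSpace ℝ (Fin 2)) {T a η : ℝ} (hT : 0 < T)
    (ha : 0 < a) (hη : 2 < η) (lam : ℝ) :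
    ∫⁻ x, ENNReal.ofReal (logAttenuation T η a (dist u x)) ∂(ENNReal.ofReal lam • volume) ≠ ∞ := by
  rw [lintegral_smul_measure]
  refine ENNReal.mul_ne_top ENNReal.ofReal_ne_top ?_
  have h := (integrable_dist_rpow_far u ha hη).const_mul (T * a ^ η)
  refine ((lintegral_mono fun x => ENNReal.ofReal_le_ofReal
    (logAttenuation_le hT ha.le η (dist u x))).trans_lt ?_).ne
  exact h.lintegral_lt_top

/-- Polar coordinates, then `v = y ^ 2` and a rescaling `w = c v`, turn the exponent of the Laplace
functional into the integral defining `vartheta`. -/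
theorem integral_one_sub_exp_neg_logAttenuation (u : EuclideanSpace ℝ (Fin 2)) {T a η lam : ℝ}
    (hT : 0 < T) (ha : 0 < a) (hη : 2 < η) (hlam : 0 < lam) :
    ∫ x, (1 - Real.exp (-logAttenuation T η a (dist u x))) ∂(ENNReal.ofReal lam • volume) =
      Real.pi * lam * a ^ 2 * vartheta T η := by
  simp only [exp_neg_logAttenuation hT ha.le]
  rw [integral_smul_measure, ENNReal.toReal_ofReal hlam.le, smul_eq_mul,
    integral_comp_dist (fun r => if a < r then 1 - 1 / (1 + T * a ^ η * r ^ (-η)) else 0) u]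
  have h1 : ∫ y in Set.Ioi 0, y * (if a < y then 1 - 1 / (1 + T * a ^ η * y ^ (-η)) else 0) =
      ∫ y in Set.Ioi a, y * (1 - 1 / (1 + T * a ^ η * y ^ (-η))) := by
    rw [← integral_indicator measurableSet_Ioi, ← integral_indicator measurableSet_Ioi]
    refine integral_congr_ae (Filter.Eventually.of_forall fun y => ?_)
    by_cases h : a < y
    · simp [h, ha.trans h]
    · simp [h]
  have hη0 : 0 < η := by linarith
  -- This scale makes `(c v) ^ (η / 2)` the inverse of `T a ^ η v ^ (-η / 2)`, and sends the lower
  -- limit `a ^ 2` to `T ^ (-2 / η)`.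
  set c := T ^ (-2 / η) / a ^ 2 with hc
  have hTp : 0 < T ^ (-2 / η) := Real.rpow_pos_of_pos hT _
  have hc0 : 0 < c := by positivity
  have hk {v : ℝ} (hv : 0 < v) :
      1 - 1 / (1 + T * a ^ η * v ^ (-η / 2)) = 1 / (1 + (c * v) ^ (η / 2)) := by
    have e1 : (c * v) ^ (η / 2) = (T * a ^ η * v ^ (-η / 2))⁻¹ := by
      rw [hc, Real.mul_rpow (by positivity) hv.le, Real.div_rpow (by positivity) (by positivity),
        ← Real.rpow_mul hT.le, ← Real.rpow_natCast a 2, ← Real.rpow_mul ha.le]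
      have e2 : -2 / η * (η / 2) = -1 := by field_simp
      have e3 : ((2 : ℕ) : ℝ) * (η / 2) = η := by push_cast; ring
      rw [e2, e3, Real.rpow_neg_one, show -η / 2 = -(η / 2) by ring, Real.rpow_neg hv.le]
      field_simp
    rw [e1]
    have : 0 < T * a ^ η * v ^ (-η / 2) := by positivity
    field_simp
    ring
  have h2 := integral_comp_rpow_Ioi_of_pos' (p := 2) two_pos (c := a ^ 2) (sq_nonneg a)
    (g := fun v => 1 / (1 + (c * v) ^ (η / 2)))
  have h3 : (a ^ 2 : ℝ) ^ (2 : ℝ)⁻¹ = a := by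
    rw [← Real.rpow_natCast a 2, ← Real.rpow_mul ha.le]
    norm_num
  rw [h3] at h2
  have h4 := integral_comp_mul_left_Ioi (fun w => 1 / (1 + w ^ (η / 2))) (a ^ 2) hc0
  rw [h4] at h2
  have h5 : ∫ y in Set.Ioi a, y * (1 - 1 / (1 + T * a ^ η * y ^ (-η))) =
      2⁻¹ * ∫ x in Set.Ioi a,
        (2 * x ^ ((2 : ℝ) - 1)) • (1 / (1 + (c * x ^ (2 : ℝ)) ^ (η / 2))) := by
    rw [← integral_const_mul]
    refine setIntegral_congr_fun measurableSet_Ioi fun y (hy : a < y) => ?_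
    have hy0 : 0 < y := ha.trans hy
    have e1 : (y ^ (2 : ℝ)) ^ (-η / 2) = y ^ (-η) := by
      rw [← Real.rpow_mul hy0.le]; congr 1; ring
    simp only [← hk (Real.rpow_pos_of_pos hy0 2), e1, smul_eq_mul]
    rw [show (2 : ℝ) - 1 = 1 by norm_num, Real.rpow_one]
    ring
  rw [h1, h5, h2]
  have h6 : c * a ^ 2 = T ^ (-2 / η) := by rw [hc]; field_simp
  have h7 : c⁻¹ = a ^ 2 * T ^ (2 / η) := by
    rw [hc, inv_div, neg_div, Real.rpow_neg hT.le]
    field_simp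
  rw [h6, h7, vartheta, smul_eq_mul]
  ring

theorem toReal_intensity_closedBall {lam s : ℝ} (hlam : 0 < lam) (hs : 0 ≤ s)
    (u : EuclideanSpace ℝ (Fin 2)) :
    ((ENNReal.ofReal lam • volume : Measure (EuclideanSpace ℝ (Fin 2)))
      (Metric.closedBall u s)).toReal = Real.pi * lam * s ^ 2 := by
  simp [hlam.le, hs, Real.pi_pos.le]
  ring

theorem intensity_closedBall_ne_top (lam s : ℝ) (u : EuclideanSpace ℝ (Fin 2)) :
    (ENNReal.ofReal lam • volume : Measure (EuclideanSpace ℝ (Fin 2)))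
      (Metric.closedBall u s) ≠ ∞ := by
  rw [Measure.smul_apply, smul_eq_mul]
  exact ENNReal.mul_ne_top ENNReal.ofReal_ne_top measure_closedBall_lt_top.ne

/-! ### Nearest and second nearest indices of a locally finite sequence of distances. -/

/-- Local finiteness makes minima exist, so the `sInf` in the index definitions is taken over a
nonempty set and is not the default value `0`. -/
theorem exists_le_of_finite_sublevel {d : ℕ → ℝ} (hfin : ∀ s, {n | d n ≤ s}.Finite) (p : ℕ → Prop)
    (hp : ∃ n, p n) : ∃ n, p n ∧ ∀ m, p m → d n ≤ d m := by
  obtain ⟨n₀, hn₀⟩ := hp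
  obtain ⟨n, ⟨hn1, hn2⟩, hn⟩ := Set.exists_min_image ({n | d n ≤ d n₀} ∩ {n | p n}) d
    ((hfin _).inter_of_left _) ⟨n₀, le_refl (d n₀), hn₀⟩
  refine ⟨n, hn2, fun m hm => ?_⟩
  rcases le_total (d m) (d n₀) with h | h
  · exact hn m ⟨h, hm⟩
  · exact le_trans hn1 h

theorem nearestIdx_le {d : ℕ → ℝ} (hfin : ∀ s, {n | d n ≤ s}.Finite) (m : ℕ) :
    d (nearestIdx d) ≤ d m := by
  obtain ⟨n, -, hn⟩ := exists_le_of_finite_sublevel hfin (fun _ => True) ⟨0, trivial⟩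
  exact Nat.sInf_mem (s := {n | ∀ m, d n ≤ d m}) ⟨n, fun m => hn m trivial⟩ m

theorem secondNearestIdx_spec {d : ℕ → ℝ} (hfin : ∀ s, {n | d n ≤ s}.Finite) :
    secondNearestIdx d ≠ nearestIdx d ∧
      ∀ m, m ≠ nearestIdx d → d (secondNearestIdx d) ≤ d m := by
  obtain ⟨n, hn1, hn2⟩ := exists_le_of_finite_sublevel hfin (fun n => n ≠ nearestIdx d)
    ⟨nearestIdx d + 1, by simp⟩
  exact Nat.sInf_mem (s := {n | n ≠ nearestIdx d ∧ ∀ m, m ≠ nearestIdx d → d n ≤ d m})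
    ⟨n, hn1, hn2⟩

theorem nearestIdx_lt_iff {d : ℕ → ℝ} (hinj : Function.Injective d)
    (hfin : ∀ s, {n | d n ≤ s}.Finite) (m : ℕ) :
    d (nearestIdx d) < d m ↔ m ≠ nearestIdx d := by
  refine ⟨fun h e => ?_, fun h => (nearestIdx_le hfin m).lt_of_ne fun e => h (hinj e).symm⟩
  rw [e] at h
  exact lt_irrefl _ h

theorem nearestIdx_lt_secondNearestIdx {d : ℕ → ℝ} (hinj : Function.Injective d)
    (hfin : ∀ s, {n | d n ≤ s}.Finite) : d (nearestIdx d) < d (secondNearestIdx d) :=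
  (nearestIdx_lt_iff hinj hfin _).2 (secondNearestIdx_spec hfin).1

theorem secondNearestIdx_lt_iff {d : ℕ → ℝ} (hinj : Function.Injective d)
    (hfin : ∀ s, {n | d n ≤ s}.Finite) (m : ℕ) :
    d (secondNearestIdx d) < d m ↔ m ≠ secondNearestIdx d ∧ m ≠ nearestIdx d := by
  constructor
  · intro h
    refine ⟨?_, ?_⟩ <;> rintro rfl
    · exact lt_irrefl _ h
    · exact lt_irrefl _ (h.trans (nearestIdx_lt_secondNearestIdx hinj hfin))
  · rintro ⟨h1, h2⟩
    exact ((secondNearestIdx_spec hfin).2 m h2).lt_of_ne fun e => h1 (hinj e).symm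

theorem lt_nearestIdx_iff {d : ℕ → ℝ} (hfin : ∀ s, {n | d n ≤ s}.Finite) (s : ℝ) :
    s < d (nearestIdx d) ↔ {n | d n ≤ s}.encard ≤ 0 := by
  simp only [nonpos_iff_eq_zero, Set.encard_eq_zero, Set.eq_empty_iff_forall_notMem,
    Set.mem_ofPred_eq, not_le]
  exact ⟨fun h n => h.trans_le (nearestIdx_le hfin n), fun h => h _⟩

/-- Makes the event that the second distance exceeds `s` a condition on the number of points in one
disc, which is what independence of the Poisson counts can use. -/
theorem lt_secondNearestIdx_iff {d : ℕ → ℝ} (hfin : ∀ s, {n | d n ≤ s}.Finite) (s : ℝ) :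
    s < d (secondNearestIdx d) ↔ {n | d n ≤ s}.encard ≤ 1 := by
  rw [Set.encard_le_one_iff_subsingleton]
  have hs := secondNearestIdx_spec hfin
  constructor
  · intro h
    refine Set.subsingleton_of_forall_eq (nearestIdx d) fun n hn => ?_
    by_contra hne
    exact (h.trans_le (hs.2 n hne)).not_ge hn
  · intro h
    by_contra hle
    rw [not_lt] at hle
    exact hs.1 (h hle ((nearestIdx_le hfin _).trans hle))

theorem nearestIdx_le_and_lt_secondNearestIdx_iff {d : ℕ → ℝ}
    (hfin : ∀ s, {n | d n ≤ s}.Finite) {s a : ℝ} (hsa : s ≤ a) :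
    d (nearestIdx d) ≤ s ∧ a < d (secondNearestIdx d) ↔
      {n | d n ≤ s}.encard = 1 ∧ {n | s < d n ∧ d n ≤ a}.encard = 0 := by
  have hs := secondNearestIdx_spec hfin
  rw [Set.encard_eq_one, Set.encard_eq_zero]
  constructor
  · rintro ⟨h1, h2⟩
    have hu (n : ℕ) (hn : d n ≤ a) : n = nearestIdx d := by
      by_contra hne
      exact (h2.trans_le (hs.2 n hne)).not_ge hn
    refine ⟨⟨nearestIdx d, Set.eq_singleton_iff_unique_mem.2 ⟨h1, fun n hn =>
      hu n (le_trans hn hsa)⟩⟩, Set.eq_empty_iff_forall_notMem.2 ?_⟩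
    rintro n ⟨hn1, hn2⟩
    rw [hu n hn2] at hn1
    exact hn1.not_ge h1
  · rintro ⟨⟨n, hn⟩, h2⟩
    have hn' := Set.eq_singleton_iff_unique_mem.1 hn
    have h1 : d (nearestIdx d) ≤ s := (nearestIdx_le hfin n).trans hn'.1
    refine ⟨h1, ?_⟩
    by_contra hle
    rw [not_lt] at hle
    rcases le_or_gt (d (secondNearestIdx d)) s with h3 | h3
    · exact hs.1 ((hn'.2 _ h3).trans (hn'.2 _ h1).symm)
    · exact Set.eq_empty_iff_forall_notMem.1 h2 _ ⟨h3, hle⟩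

theorem measurable_sInf_nat {α : Type*} [MeasurableSpace α] {S : α → Set ℕ}
    (hS : ∀ n, MeasurableSet {a | n ∈ S a}) : Measurable fun a => sInf (S a) := by
  refine measurable_to_countable' fun k => ?_
  have hlt : MeasurableSet {a | ∀ j < k, j ∉ S a} := by
    simp only [Set.ofPred_forall]
    exact MeasurableSet.iInter fun j => MeasurableSet.iInter fun _ => (hS j).compl
  have hemp : MeasurableSet {a | S a = ∅} := by
    simp only [Set.eq_empty_iff_forall_notMem, Set.ofPred_forall]
    exact MeasurableSet.iInter fun j => (hS j).compl
  -- The value `0` is also taken where the set is empty, hence the second piece.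
  have heq : (fun a => sInf (S a)) ⁻¹' {k} =
      ({a | k ∈ S a} ∩ {a | ∀ j < k, j ∉ S a}) ∪ ({a | S a = ∅} ∩ {_a | k = 0}) := by
    ext a
    simp only [Set.mem_preimage, Set.mem_singleton_iff, Set.mem_union, Set.mem_inter_iff,
      Set.mem_ofPred_eq]
    constructor
    · rintro rfl
      rcases (S a).eq_empty_or_nonempty with h | h
      · right
        simp [h]
      · left
        exact ⟨Nat.sInf_mem h, fun j hj => Nat.notMem_of_lt_sInf hj⟩
    · rintro (⟨h1, h2⟩ | ⟨h1, rfl⟩)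
      · refine le_antisymm (Nat.sInf_le h1) ?_
        by_contra hlt
        exact h2 _ (not_le.1 hlt) (Nat.sInf_mem ⟨k, h1⟩)
      · simp [h1]
  rw [heq]
  exact ((hS k).inter hlt).union (hemp.inter (MeasurableSet.const _))

theorem measurable_nearestIdx : Measurable nearestIdx := by
  refine measurable_sInf_nat fun n => ?_
  change MeasurableSet {d : ℕ → ℝ | ∀ m, d n ≤ d m}
  rw [Set.ofPred_forall]
  exact MeasurableSet.iInter fun m =>
    measurableSet_le (measurable_pi_apply n) (measurable_pi_apply m)

theorem measurable_secondNearestIdx : Measurable secondNearestIdx := by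
  refine measurable_sInf_nat fun n => ?_
  have h1 (m : ℕ) : MeasurableSet {d : ℕ → ℝ | m ≠ nearestIdx d} := by
    have := measurable_nearestIdx (measurableSet_singleton m).compl
    refine (congrArg MeasurableSet (Set.ext fun d => ?_)).mp this
    exact ⟨fun h e => h e.symm, fun h e => h e.symm⟩
  change MeasurableSet {d : ℕ → ℝ | n ≠ nearestIdx d ∧ ∀ m, m ≠ nearestIdx d → d n ≤ d m}
  rw [Set.ofPred_and, Set.ofPred_forall]
  refine (h1 n).inter (MeasurableSet.iInter fun m => ?_)
  have h3 : MeasurableSet {d : ℕ → ℝ | m ≠ nearestIdx d → d n ≤ d m} := by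
    have h4 : {d : ℕ → ℝ | m ≠ nearestIdx d → d n ≤ d m} =
        {d | m ≠ nearestIdx d}ᶜ ∪ {d | d n ≤ d m} := by
      ext d
      simp only [Set.mem_ofPred_eq, Set.mem_union, Set.mem_compl_iff]
      tauto
    rw [h4]
    exact (h1 m).compl.union (measurableSet_le (measurable_pi_apply n) (measurable_pi_apply m))
  exact h3

theorem measurable_apply_of_nat {α : Type*} [MeasurableSpace α] {v : ℕ → α → ℝ} {k : α → ℕ}
    (hv : ∀ n, Measurable (v n)) (hk : Measurable k) : Measurable fun a => v (k a) a := by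
  have h : Measurable fun p : ℕ × α => v p.1 p.2 := measurable_from_prod_countable_right hv
  exact h.comp (hk.prodMk measurable_id)

theorem measurable_nearest_dist : Measurable fun d : ℕ → ℝ => d (nearestIdx d) :=
  measurable_apply_of_nat measurable_pi_apply measurable_nearestIdx

theorem measurable_secondNearest_dist : Measurable fun d : ℕ → ℝ => d (secondNearestIdx d) :=
  measurable_apply_of_nat measurable_pi_apply measurable_secondNearestIdx

/-! ### Poisson probabilities; absence of ties; joint law of the two smallest distances. -/

namespace IsPoissonPointProcess

section General

variable {Ω E : Type*} [MeasurableSpace Ω] [MeasurableSpace E] {X : ℕ → Ω → E} {ν : Measure E}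
  {μ : Measure Ω}

theorem measureReal_pointCount_eq (hX : IsPoissonPointProcess X ν μ) {A : Set E}
    (hA : MeasurableSet A) (hν : ν A ≠ ∞) (k : ℕ) :
    μ.real {ω | pointCount (fun n => X n ω) A = k} =
      Real.exp (-(ν A).toReal) * (ν A).toReal ^ k / k.factorial := by
  rw [measureReal_def, hX.measure_pointCount_eq hA hν,
    ENNReal.toReal_ofReal (by positivity)]

theorem measureReal_two_le_pointCount [IsProbabilityMeasure μ] (hX : IsPoissonPointProcess X ν μ)
    {A : Set E} (hA : MeasurableSet A) (hν : ν A ≠ ∞) :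
    μ.real {ω | 2 ≤ pointCount (fun n => X n ω) A} ≤ (ν A).toReal ^ 2 := by
  have hm (k : ℕ) : MeasurableSet {ω | pointCount (fun n => X n ω) A = k} :=
    measurable_pointCount hX.measurable hA (measurableSet_singleton _)
  have hd : Disjoint {ω | pointCount (fun n => X n ω) A = (0 : ℕ)}
      {ω | pointCount (fun n => X n ω) A = (1 : ℕ)} := by
    refine Set.disjoint_left.2 fun ω h0 h1 => ?_
    have h2 : ((0 : ℕ) : ℝ≥0∞) = (1 : ℕ) := Eq.trans (Eq.symm h0) h1
    simp at h2
  have hsub : {ω | 2 ≤ pointCount (fun n => X n ω) A} ⊆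
      ({ω | pointCount (fun n => X n ω) A = (0 : ℕ)} ∪
        {ω | pointCount (fun n => X n ω) A = (1 : ℕ)})ᶜ := by
    rintro ω (h : 2 ≤ pointCount (fun n => X n ω) A) (h0 | h0)
    all_goals
      rw [show pointCount (fun n => X n ω) A = _ from h0] at h
      simp at h
  refine (measureReal_mono hsub).trans ?_
  rw [probReal_compl_eq_one_sub ((hm 0).union (hm 1)), measureReal_union hd (hm 1),
    hX.measureReal_pointCount_eq hA hν, hX.measureReal_pointCount_eq hA hν]
  have h0 : 0 ≤ (ν A).toReal := ENNReal.toReal_nonneg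
  have h1 := Real.add_one_le_exp (-(ν A).toReal)
  simp only [pow_zero, mul_one, Nat.factorial_zero, Nat.cast_one, div_one, pow_one,
    Nat.factorial_one]
  -- With `x` the mean, `exp (-x) ≥ 1 - x` gives `1 - exp (-x) (1 + x) ≤ x ^ 2`.
  nlinarith

theorem measureReal_pointCount_eq_one_and_eq_zero (hX : IsPoissonPointProcess X ν μ)
    {A B : Set E} (hA : MeasurableSet A) (hνA : ν A ≠ ∞) (hB : MeasurableSet B) (hνB : ν B ≠ ∞)
    (hAB : Disjoint A B) :
    μ.real {ω | pointCount (fun n => X n ω) A = 1 ∧ pointCount (fun n => X n ω) B = 0} =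
      (ν A).toReal * Real.exp (-((ν A).toReal + (ν B).toReal)) := by
  have hd : Pairwise fun i j : Bool => Disjoint (cond i A B) (cond j A B) := by
    rintro (_ | _) (_ | _) h
    · exact absurd rfl h
    · exact hAB.symm
    · exact hAB
    · exact absurd rfl h
  have hind := (hX.iIndepFun_pointCount (A := fun i : Bool => cond i A B)
    (by rintro (_ | _); exacts [hB, hA]) hd).indepFun (show true ≠ false by decide)
  have h1 := hind.measure_inter_preimage_eq_mul {((1 : ℕ) : ℝ≥0∞)} {((0 : ℕ) : ℝ≥0∞)}
    (measurableSet_singleton _) (measurableSet_singleton _)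
  have h2 := hX.measureReal_pointCount_eq hA hνA 1
  have h3 := hX.measureReal_pointCount_eq hB hνB 0
  have h4 : {ω | pointCount (fun n => X n ω) A = 1 ∧ pointCount (fun n => X n ω) B = 0} =
      {ω | pointCount (fun n => X n ω) A = (1 : ℕ)} ∩
        {ω | pointCount (fun n => X n ω) B = (0 : ℕ)} := by
    ext ω; simp
  have h5 : μ.real ({ω | pointCount (fun n => X n ω) A = (1 : ℕ)} ∩
      {ω | pointCount (fun n => X n ω) B = (0 : ℕ)}) =
      μ.real {ω | pointCount (fun n => X n ω) A = (1 : ℕ)} *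
        μ.real {ω | pointCount (fun n => X n ω) B = (0 : ℕ)} := by
    simp only [measureReal_def, ← ENNReal.toReal_mul]
    exact congrArg ENNReal.toReal h1
  rw [h4, h5, h2, h3, neg_add, Real.exp_add]
  simp
  ring

end General

section Planar

variable {Ω : Type*} [MeasurableSpace Ω] {μ : Measure Ω} {lam : ℝ}
  {X : ℕ → Ω → EuclideanSpace ℝ (Fin 2)}

/-- Cut the disc of radius `L` into `L K'` annuli of width `1 / K'`. A tie puts two points into one
annulus, whose intensity is at most `2 π λ L / K'`. Each annulus thus has probability `O(1 / K' ^
2)` of holding two points, and the union bound is `O(1 / K')`. -/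
theorem ae_injective_dist [IsProbabilityMeasure μ]
    (hX : IsPoissonPointProcess X (ENNReal.ofReal lam • volume) μ)
    (hlam : 0 < lam) (u : EuclideanSpace ℝ (Fin 2)) :
    ∀ᵐ ω ∂μ, Function.Injective fun n => dist u (X n ω) := by
  have key (L : ℕ) : ∀ᵐ ω ∂μ, ¬ ∃ n m, n ≠ m ∧ dist u (X n ω) = dist u (X m ω) ∧
      dist u (X n ω) < L := by
    rw [ae_iff]
    simp only [not_not]
    set tie := {ω | ∃ n m, n ≠ m ∧ dist u (X n ω) = dist u (X m ω) ∧ dist u (X n ω) < L}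
    have hbound (K : ℕ) : μ.real tie ≤ L * (2 * Real.pi * lam * L) ^ 2 / (K + 1 : ℕ) := by
      set K' : ℕ := K + 1
      have hK : (0 : ℝ) < K' := by positivity
      let A : ℕ → Set (EuclideanSpace ℝ (Fin 2)) := fun k => {x | ⌊dist u x * K'⌋₊ = k}
      have hA (k : ℕ) : MeasurableSet (A k) := by
        have : Measurable fun x => ⌊dist u x * K'⌋₊ :=
          Nat.measurable_floor.comp (by fun_prop)
        exact this (measurableSet_singleton k)
      have hsubA (k : ℕ) : A k ⊆ Metric.closedBall u ((k + 1 : ℝ) / K') \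
          Metric.ball u (k / K') := by
        intro x hx
        have h1 := Nat.lt_floor_add_one (dist u x * K')
        have h2 := Nat.floor_le (a := dist u x * K') (by positivity)
        rw [show ⌊dist u x * K'⌋₊ = k from hx] at h1 h2
        rw [Set.mem_sdiff, Metric.mem_closedBall', Metric.mem_ball', not_lt, le_div_iff₀ hK,
          div_le_iff₀ hK]
        exact ⟨h1.le, h2⟩
      have hνtop (k : ℕ) : (ENNReal.ofReal lam • volume : Measure _) (A k) ≠ ∞ :=
        ((measure_mono ((hsubA k).trans Set.sdiff_subset)).trans_lt
          (intensity_closedBall_ne_top lam _ u).lt_top).ne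
      have hν (k : ℕ) : ((ENNReal.ofReal lam • volume : Measure _) (A k)).toReal ≤
          Real.pi * lam * (2 * k + 1) / K' ^ 2 := by
        have hbs : Metric.ball u ((k : ℝ) / K') ⊆ Metric.closedBall u ((k + 1 : ℝ) / K') :=
          Metric.ball_subset_closedBall.trans (Metric.closedBall_subset_closedBall (by gcongr; simp))
        have htop : (ENNReal.ofReal lam • volume : Measure _)
          (Metric.closedBall u ((k + 1 : ℝ) / K') \ Metric.ball u (k / K')) ≠ ∞ :=
          ((measure_mono Set.sdiff_subset).trans_lt
            (intensity_closedBall_ne_top lam _ u).lt_top).ne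
        refine (ENNReal.toReal_mono htop (measure_mono (hsubA k))).trans ?_
        rw [measure_sdiff hbs measurableSet_ball.nullMeasurableSet
          ((measure_mono hbs).trans_lt (intensity_closedBall_ne_top lam _ u).lt_top).ne,
          ENNReal.toReal_sub_of_le (measure_mono hbs) (intensity_closedBall_ne_top lam _ u),
          toReal_intensity_closedBall hlam (by positivity)]
        have hb : ((ENNReal.ofReal lam • volume : Measure (EuclideanSpace ℝ (Fin 2)))
            (Metric.ball u ((k : ℝ) / K'))).toReal = Real.pi * lam * (k / K') ^ 2 := by
          rw [Measure.smul_apply, ← Measure.addHaar_closedBall_eq_addHaar_ball,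
            ← Measure.smul_apply, toReal_intensity_closedBall hlam (by positivity)]
        rw [hb]
        apply le_of_eq
        field_simp
        ring
      have hsub : tie ⊆ ⋃ k ∈ Finset.range (L * K'),
          {ω | 2 ≤ pointCount (fun n => X n ω) (A k)} := by
        rintro ω ⟨n, m, hnm, hd, hL⟩
        simp only [Set.mem_iUnion]
        refine ⟨⌊dist u (X n ω) * K'⌋₊, ?_, ?_⟩
        · rw [Finset.mem_range, Nat.floor_lt (by positivity)]
          push_cast
          gcongr
        · change 2 ≤ pointCount _ _
          rw [pointCount_eq_encard]
          have h1 : (1 : ℕ∞) < {i | X i ω ∈ A ⌊dist u (X n ω) * K'⌋₊}.encard :=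
            Set.one_lt_encard_iff.2 ⟨n, m, rfl, by
              change ⌊dist u (X m ω) * K'⌋₊ = _
              rw [hd], hnm⟩
          have h2 := Order.add_one_le_of_lt h1
          have h3 := ENat.toENNReal_le.2 h2
          simpa [one_add_one_eq_two] using h3
      calc μ.real tie ≤ ∑ k ∈ Finset.range (L * K'),
            μ.real {ω | 2 ≤ pointCount (fun n => X n ω) (A k)} :=
            (measureReal_mono hsub (measure_ne_top _ _)).trans (measureReal_biUnion_finset_le _ _)
        _ ≤ ∑ k ∈ Finset.range (L * K'), (2 * Real.pi * lam * L / K') ^ 2 := by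
            refine Finset.sum_le_sum fun k hk => ?_
            refine (hX.measureReal_two_le_pointCount (hA k) (hνtop k)).trans ?_
            refine pow_le_pow_left₀ ENNReal.toReal_nonneg ((hν k).trans ?_) 2
            have hkL : (k : ℝ) + 1 ≤ L * K' := by exact_mod_cast Finset.mem_range.1 hk
            rw [div_le_div_iff₀ (by positivity) hK]
            have hp := Real.pi_pos
            have : (2 * k + 1 : ℝ) ≤ 2 * (L * K') := by linarith
            calc Real.pi * lam * (2 * k + 1) * K' ≤ Real.pi * lam * (2 * (L * K')) * K' := by gcongr
              _ = _ := by ring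
        _ = _ := by
            rw [Finset.sum_const, Finset.card_range, nsmul_eq_mul]
            push_cast
            field_simp
    have hlim : Filter.Tendsto (fun K : ℕ => L * (2 * Real.pi * lam * L) ^ 2 / ((K + 1 : ℕ) : ℝ))
        Filter.atTop (nhds 0) :=
      (tendsto_const_div_atTop_nhds_zero_nat _).comp (Filter.tendsto_add_atTop_nat 1)
    have h0 : μ.real tie ≤ 0 := ge_of_tendsto' hlim hbound
    exact (measureReal_eq_zero_iff).1 (le_antisymm h0 measureReal_nonneg)
  filter_upwards [ae_all_iff.2 key] with ω hω n m hnm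
  by_contra hne
  obtain ⟨L, hL⟩ := exists_nat_gt (dist u (X n ω))
  exact hω L ⟨n, m, hne, hnm, hL⟩

theorem ae_finite_sublevel (hX : IsPoissonPointProcess X (ENNReal.ofReal lam • volume) μ)
    (u : EuclideanSpace ℝ (Fin 2)) :
    ∀ᵐ ω ∂μ, ∀ s, {n | dist u (X n ω) ≤ s}.Finite := by
  have h := ae_all_iff.2 fun L : ℕ => hX.ae_pointCount_ne_top (A := Metric.closedBall u L)
    measurableSet_closedBall (intensity_closedBall_ne_top lam _ u)
  filter_upwards [h] with ω hω s
  obtain ⟨L, hL⟩ := exists_nat_ge s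
  have h1 := hω L
  rw [pointCount_eq_encard, ne_eq, ENat.toENNReal_eq_top] at h1
  refine (Set.encard_ne_top_iff.1 h1).subset fun n hn => ?_
  exact Metric.mem_closedBall'.2 (le_trans hn hL)

theorem ae_dist_pos [IsProbabilityMeasure μ]
    (hX : IsPoissonPointProcess X (ENNReal.ofReal lam • volume) μ)
    (hlam : 0 < lam) (u : EuclideanSpace ℝ (Fin 2)) : ∀ᵐ ω ∂μ, ∀ n, 0 < dist u (X n ω) := by
  have h := hX.measure_pointCount_eq (A := Metric.closedBall u 0)
    measurableSet_closedBall (intensity_closedBall_ne_top lam _ u) 0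
  rw [toReal_intensity_closedBall hlam le_rfl] at h
  have h1 : ∀ᵐ ω ∂μ, pointCount (fun n => X n ω) (Metric.closedBall u 0) = (0 : ℕ) := by
    refine (prob_compl_eq_zero_iff (measurable_pointCount hX.measurable
      measurableSet_closedBall (measurableSet_singleton _))).2 (h.trans ?_)
    simp
  filter_upwards [h1] with ω hω n
  rw [Nat.cast_zero, pointCount, ENNReal.tsum_eq_zero] at hω
  have h2 := hω n
  rw [Set.indicator_apply_eq_zero] at h2
  by_contra hle
  exact one_ne_zero (h2 (Metric.mem_closedBall'.2 (not_lt.1 hle)))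

/-- The event says that the disc of radius `s` holds exactly one point and the annulus between `s`
and `a` none; these counts are independent. -/
theorem measureReal_nearest_le_and_lt_second
    (hX : IsPoissonPointProcess X (ENNReal.ofReal lam • volume) μ)
    (hlam : 0 < lam) (u : EuclideanSpace ℝ (Fin 2)) {s a : ℝ} (hs : 0 ≤ s) (hsa : s ≤ a) :
    μ.real {ω | dist u (X (nearestIdx fun n => dist u (X n ω)) ω) ≤ s ∧
      a < dist u (X (secondNearestIdx fun n => dist u (X n ω)) ω)} =
      Real.pi * lam * s ^ 2 * Real.exp (-(Real.pi * lam * a ^ 2)) := by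
  have hsub : Metric.closedBall u s ⊆ Metric.closedBall u a :=
    Metric.closedBall_subset_closedBall hsa
  have hνB : (ENNReal.ofReal lam • volume : Measure _)
      (Metric.closedBall u a \ Metric.closedBall u s) ≠ ∞ :=
    ((measure_mono Set.sdiff_subset).trans_lt (intensity_closedBall_ne_top lam _ u).lt_top).ne
  have h := hX.measureReal_pointCount_eq_one_and_eq_zero (A := Metric.closedBall u s)
    (B := Metric.closedBall u a \ Metric.closedBall u s) measurableSet_closedBall
    (intensity_closedBall_ne_top lam _ u)
    (measurableSet_closedBall.diff measurableSet_closedBall) hνB Set.disjoint_sdiff_right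
  rw [measure_sdiff hsub measurableSet_closedBall.nullMeasurableSet
    (intensity_closedBall_ne_top lam _ u), ENNReal.toReal_sub_of_le (measure_mono hsub)
    (intensity_closedBall_ne_top lam _ u), toReal_intensity_closedBall hlam hs,
    toReal_intensity_closedBall hlam (hs.trans hsa), add_sub_cancel] at h
  rw [← h]
  refine measureReal_congr ?_
  filter_upwards [hX.ae_finite_sublevel u] with ω hω
  refine propext ?_
  change (_ ∧ _) ↔ (_ ∧ _)
  rw [nearestIdx_le_and_lt_secondNearestIdx_iff (d := fun n => dist u (X n ω)) hω hsa,
    pointCount_eq_encard, pointCount_eq_encard, ← ENat.toENNReal_one, ← ENat.toENNReal_zero,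
    ENat.toENNReal_inj, ENat.toENNReal_inj]
  have e1 : {n | X n ω ∈ Metric.closedBall u s} = {n | dist u (X n ω) ≤ s} :=
    Set.ext fun n => Metric.mem_closedBall'
  have e2 : {n | X n ω ∈ Metric.closedBall u a \ Metric.closedBall u s} =
      {n | s < dist u (X n ω) ∧ dist u (X n ω) ≤ a} := by
    refine Set.ext fun n => ?_
    change _ ∧ ¬ _ ↔ _ ∧ _
    rw [Metric.mem_closedBall', Metric.mem_closedBall', not_le, and_comm]
  rw [e1, e2]

end Planar

end IsPoissonPointProcess

/-! ### Interference from beyond the serving distance. -/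

theorem vartheta_nonneg {T : ℝ} (hT : 0 < T) (η : ℝ) : 0 ≤ vartheta T η := by
  refine mul_nonneg (Real.rpow_nonneg hT.le _) (setIntegral_nonneg measurableSet_Ioi ?_)
  intro w hw
  have : 0 < w := (Real.rpow_pos_of_pos hT _).trans hw
  positivity

instance sigmaFinite_ofReal_smul {E : Type*} [MeasurableSpace E] (ν : Measure E) [SigmaFinite ν]
    (r : ℝ) : SigmaFinite (ENNReal.ofReal r • ν) :=
  inferInstanceAs (SigmaFinite (r.toNNReal • ν))

namespace IsPoissonPointProcess

variable {Ω : Type*} [MeasurableSpace Ω] {μ : Measure Ω} {lam : ℝ}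
  {X : ℕ → Ω → EuclideanSpace ℝ (Fin 2)}

/-- Campbell's formula handles the points beyond distance `1`. The others are finitely many, so they
do not affect summability even though the path loss is not integrable near `u`. -/
theorem ae_summable_dist_rpow (hX : IsPoissonPointProcess X (ENNReal.ofReal lam • volume) μ)
    (u : EuclideanSpace ℝ (Fin 2)) {η : ℝ} (hη : 2 < η) :
    ∀ᵐ ω ∂μ, Summable fun n => dist u (X n ω) ^ (-η) := by
  have hfm : Measurable fun x : EuclideanSpace ℝ (Fin 2) =>
      ENNReal.ofReal (if 1 < dist u x then dist u x ^ (-η) else 0) :=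
    (Measurable.ite (measurableSet_lt measurable_const (by fun_prop)) (by fun_prop)
      measurable_const).ennreal_ofReal
  have hi : ∫⁻ x, ENNReal.ofReal (if 1 < dist u x then dist u x ^ (-η) else 0)
      ∂(ENNReal.ofReal lam • volume) ≠ ∞ := by
    rw [lintegral_smul_measure]
    exact ENNReal.mul_ne_top ENNReal.ofReal_ne_top
      (integrable_dist_rpow_far u one_pos hη).lintegral_lt_top.ne
  rw [← hX.lintegral_tsum_comp hfm] at hi
  filter_upwards [ae_lt_top (Measurable.tsum fun n => hfm.comp (hX.measurable n)) hi,
    hX.ae_finite_sublevel u] with ω h1 h2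
  have h3 : Summable fun n => if 1 < dist u (X n ω) then dist u (X n ω) ^ (-η) else 0 := by
    refine (summable_iff_tsum_ofReal_ne_top fun n => ?_).2 h1.ne
    split_ifs <;> positivity
  refine h3.congr_cofinite ?_
  refine (h2 1).subset fun n hn => ?_
  by_contra hlt
  exact hn (if_pos (not_le.1 hlt))

variable [IsProbabilityMeasure μ]

/-- The exponential of the averaged interference at the frozen distance `a` is independent of the
numbers of points in discs of radius at most `a`. -/
theorem setIntegral_exp_neg_logAttenuation
    (hX : IsPoissonPointProcess X (ENNReal.ofReal lam • volume) μ) (hlam : 0 < lam)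
    (u : EuclideanSpace ℝ (Fin 2)) {T η : ℝ} (hT : 0 < T) (hη : 2 < η)
    {R : Ω → ℝ} (hR : Measurable R) {i : ℝ≥0∞}
    (hi : ∀ᵐ ω ∂μ, ∀ s, s < R ω ↔ pointCount (fun n => X n ω) (Metric.closedBall u s) ≤ i)
    {s a : ℝ} (ha : 0 < a) (hsa : s ≤ a) :
    ∫ ω in R ⁻¹' Set.Ioi s,
      Real.exp (-(∑' n, ENNReal.ofReal (logAttenuation T η a (dist u (X n ω)))).toReal) ∂μ =
    ∫ _ in R ⁻¹' Set.Ioi s, Real.exp (-(Real.pi * lam * a ^ 2 * vartheta T η)) ∂μ := by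
  -- Evaluated at the count of the disc of radius `s`, this is the indicator of `{s < R}`.
  set φ : ℝ≥0∞ → ℝ := (Set.Iic i).indicator fun _ => 1
  have hφ : Measurable φ := measurable_const.indicator measurableSet_Iic
  have hφ1 (x : ℝ≥0∞) : |φ x| ≤ 1 := by
    by_cases hx : x ∈ Set.Iic i
    · rw [show φ x = 1 from Set.indicator_of_mem hx _, abs_one]
    · rw [show φ x = 0 from Set.indicator_of_notMem hx _, abs_zero]
      exact zero_le_one
  have hfm : Measurable fun x : EuclideanSpace ℝ (Fin 2) =>
      ENNReal.ofReal (logAttenuation T η a (dist u x)) :=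
    ((measurable_logAttenuation T η).comp
      (measurable_const.prodMk (by fun_prop))).ennreal_ofReal
  have h := hX.integral_mul_exp_neg_tsum (B := Metric.closedBall u s) measurableSet_closedBall
    hφ hφ1 hfm (fun x hx => by
      have : ¬ a < dist u x := not_lt.2 ((Metric.mem_closedBall'.1 hx).trans hsa)
      simp [logAttenuation, this]) (lintegral_logAttenuation_ne_top u hT ha hη lam)
  have hind (G : Ω → ℝ) : ∫ ω, φ (pointCount (fun n => X n ω) (Metric.closedBall u s)) * G ω ∂μ =
      ∫ ω in R ⁻¹' Set.Ioi s, G ω ∂μ := by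
    rw [← integral_indicator (hR measurableSet_Ioi)]
    refine integral_congr_ae ?_
    filter_upwards [hi] with ω hω
    by_cases hs : s < R ω
    · rw [Set.indicator_of_mem (show ω ∈ R ⁻¹' Set.Ioi s from hs),
        show φ _ = 1 from Set.indicator_of_mem ((hω s).1 hs) _, one_mul]
    · rw [Set.indicator_of_notMem (show ω ∉ R ⁻¹' Set.Ioi s from hs),
        show φ _ = 0 from Set.indicator_of_notMem (fun h => hs ((hω s).2 h)) _, zero_mul]
  rw [← hind, h, ← hind, integral_mul_const]
  simp only [ENNReal.toReal_ofReal (logAttenuation_nonneg hT ha.le η _)]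
  rw [integral_one_sub_exp_neg_logAttenuation u hT ha hη hlam]

/-- The parameter must approach `R` from above: the cutoff is strict, so a point at distance exactly
`R` (the serving station) stays excluded, whereas from below it would be counted. Summability of the
path losses dominates the terms. -/
theorem tendsto_tsum_logAttenuation {d : ℕ → ℝ} (hd : ∀ n, 0 ≤ d n) {T η R : ℝ} (hT : 0 < T)
    (hη : 2 < η) (hR : 0 < R) (hs : Summable fun n => d n ^ (-η)) {v : ℕ → ℝ}
    (hv : Filter.Tendsto v Filter.atTop (nhds R)) (hRv : ∀ j, R ≤ v j) :
    Filter.Tendsto (fun j => ∑' n, logAttenuation T η (v j) (d n)) Filter.atTop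
      (nhds (∑' n, logAttenuation T η R (d n))) := by
  refine tendsto_tsum_of_dominated_convergence (hs.mul_left (T * (R + 1) ^ η)) (fun n => ?_) ?_
  · by_cases hn : R < d n
    · have h1 : Filter.Tendsto (fun j => Real.log (1 + T * v j ^ η * d n ^ (-η))) Filter.atTop
          (nhds (Real.log (1 + T * R ^ η * d n ^ (-η)))) := by
        have hp : 0 ≤ T * R ^ η * d n ^ (-η) := by have := hd n; positivity
        refine Filter.Tendsto.log ?_ (by linarith)
        exact (((hv.rpow_const (Or.inl hR.ne')).const_mul T).mul_const _).const_add 1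
      rw [show logAttenuation T η R (d n) = _ from if_pos hn]
      refine h1.congr' ?_
      filter_upwards [hv.eventually (gt_mem_nhds hn)] with j hj
      exact (if_pos hj).symm
    · rw [show logAttenuation T η R (d n) = _ from if_neg hn]
      refine tendsto_const_nhds.congr fun j => ?_
      exact (if_neg fun h => hn ((hRv j).trans_lt h)).symm
  · filter_upwards [hv.eventually (ge_mem_nhds (lt_add_one R))] with j hj n
    have hvj : 0 < v j := hR.trans_le (hRv j)
    have hdn := hd n
    rw [Real.norm_eq_abs, abs_of_nonneg (logAttenuation_nonneg hT hvj.le η _)]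
    refine (logAttenuation_le hT hvj.le η _).trans ?_
    have h1 : (if v j < d n then d n ^ (-η) else 0) ≤ d n ^ (-η) := by
      split_ifs
      · exact le_rfl
      · positivity
    have h2 : v j ^ η ≤ (R + 1) ^ η := Real.rpow_le_rpow hvj.le hj (by linarith)
    have h3 : 0 ≤ (if v j < d n then d n ^ (-η) else 0) := by
      split_ifs <;> positivity
    gcongr

/-- The averaged interference from beyond the distance `R` of a point, when the events `{s < R}`
are determined by the number of points within distance `s`. -/
theorem setIntegral_exp_neg_tsum_logAttenuation
    (hX : IsPoissonPointProcess X (ENNReal.ofReal lam • volume) μ) (hlam : 0 < lam)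
    (u : EuclideanSpace ℝ (Fin 2)) {T η : ℝ} (hT : 0 < T) (hη : 2 < η)
    {R : Ω → ℝ} (hR : Measurable R) (hR0 : ∀ᵐ ω ∂μ, 0 < R ω) {i : ℝ≥0∞}
    (hi : ∀ᵐ ω ∂μ, ∀ s, s < R ω ↔ pointCount (fun n => X n ω) (Metric.closedBall u s) ≤ i)
    {b : ℝ} (hb : 0 ≤ b) :
    ∫ ω in R ⁻¹' Set.Ioi b,
      Real.exp (-∑' n, logAttenuation T η (R ω) (dist u (X n ω))) ∂μ =
    ∫ ω in R ⁻¹' Set.Ioi b, Real.exp (-(Real.pi * lam * R ω ^ 2 * vartheta T η)) ∂μ := by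
  let W : ℝ → Ω → ℝ := fun a ω =>
    Real.exp (-(∑' n, ENNReal.ofReal (logAttenuation T η a (dist u (X n ω)))).toReal)
  let V : ℝ → Ω → ℝ := fun a _ => Real.exp (-(Real.pi * lam * a ^ 2 * vartheta T η))
  have hW : Measurable fun p : ℝ × Ω => W p.1 p.2 := by
    refine Real.measurable_exp.comp (Measurable.neg (Measurable.ennreal_toReal
      (Measurable.tsum fun n => Measurable.ennreal_ofReal ?_)))
    have hn := hX.measurable n
    exact (measurable_logAttenuation T η).comp (f := fun p : ℝ × Ω => (p.1, dist u (X n p.2)))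
      (measurable_fst.prodMk (measurable_const.dist (hn.comp measurable_snd)))
  have hV : Measurable fun p : ℝ × Ω => V p.1 p.2 := by
    simp only [V]
    fun_prop
  have hint {U : ℝ → Ω → ℝ} (hU : Measurable fun p : ℝ × Ω => U p.1 p.2)
      (hUC : ∀ a ω, |U a ω| ≤ 1) (a : ℝ) : Integrable (U a) μ :=
    (integrable_const (1 : ℝ)).mono' (hU.comp measurable_prodMk_left).aestronglyMeasurable
      (Filter.Eventually.of_forall fun ω => hUC _ _)
  have hW1 (a : ℝ) (ω : Ω) : |W a ω| ≤ 1 := by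
    rw [Real.abs_exp, Real.exp_le_one_iff]
    simp
  have hV1 (a : ℝ) (ω : Ω) : |V a ω| ≤ 1 := by
    rw [Real.abs_exp, Real.exp_le_one_iff, neg_nonpos]
    have := vartheta_nonneg hT η
    have := Real.pi_pos
    positivity
  -- Freezing at the right end `a` keeps the contributing points outside the discs of radius `s` and
  -- `a`, which determine the cell `{s < R ≤ a}`.
  refine setIntegral_Ioi_eq_of_frozen hR hW hV hW1 hV1 (θ := 1) (by simp) ?_ ?_ hb
  · intro s a hs hsa
    rw [one_mul, add_sub_cancel]
    have ha : 0 < a := hs.trans_lt hsa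
    have hset : R ⁻¹' Set.Ioc s a = R ⁻¹' Set.Ioi s \ R ⁻¹' Set.Ioi a := by
      rw [← Set.preimage_sdiff, Set.Ioi_sdiff_Ioi]
    have hsub : R ⁻¹' Set.Ioi a ⊆ R ⁻¹' Set.Ioi s :=
      Set.preimage_mono (Set.Ioi_subset_Ioi hsa.le)
    rw [hset, setIntegral_sdiff (hR measurableSet_Ioi) (hint hW hW1 a).integrableOn hsub,
      setIntegral_sdiff (hR measurableSet_Ioi) (hint hV hV1 a).integrableOn hsub]
    exact congrArg₂ _
      (hX.setIntegral_exp_neg_logAttenuation hlam u hT hη hR hi ha hsa.le)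
      (hX.setIntegral_exp_neg_logAttenuation hlam u hT hη hR hi ha le_rfl)
  · filter_upwards [hR0, hX.ae_summable_dist_rpow u hη] with ω hω hs v hv hRv _
    constructor
    · have h1 := tendsto_tsum_logAttenuation (fun n => dist_nonneg) hT hη hω hs hv (hRv rfl)
      refine (Real.continuous_exp.continuousAt.tendsto.comp h1.neg).congr fun j => ?_
      simp only [W, Function.comp_apply]
      rw [toReal_tsum_ofReal fun n =>
        logAttenuation_nonneg hT (hω.le.trans (hRv rfl j)) η _]
    · exact Real.continuous_exp.continuousAt.tendsto.comp
        (((hv.pow 2).const_mul _).mul_const _).neg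

end IsPoissonPointProcess

/-! ### The skipped nearest station. -/

/-- The integral of `1 / (1 + T v ^ (-η / 2))` over the unit interval: the mean of the attenuation
caused by a single interferer placed uniformly in the disc of the serving station. -/
noncomputable def meanAttenuation (T η : ℝ) : ℝ :=
  ∫ v in Set.Ioo (0 : ℝ) 1, 1 / (1 + T * v ^ (-η / 2))

/-- The substitution `v = (y / r) ^ 2` carries the density `2 y / r ^ 2` to the uniform one and
removes all dependence on `r`. -/
theorem intervalIntegral_attenuation_eq {r : ℝ} (hr : 0 < r) (T η : ℝ) :
    ∫ y in (0 : ℝ)..r, 1 / (1 + T * r ^ η * y ^ (-η)) * (2 * y / r ^ 2) =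
      meanAttenuation T η := by
  have h1 := integral_comp_rpow_Ioi_of_pos (p := 2) two_pos
    (g := (Set.Ioc (0 : ℝ) 1).indicator fun v => 1 / (1 + T * v ^ (-η / 2)))
  have h2 := integral_comp_mul_left_Ioi (fun x : ℝ => (2 * x ^ ((2 : ℝ) - 1)) •
    (Set.Ioc (0 : ℝ) 1).indicator (fun v => 1 / (1 + T * v ^ (-η / 2))) (x ^ (2 : ℝ))) 0
    (inv_pos.2 hr)
  rw [mul_zero, h1, inv_inv, smul_eq_mul] at h2
  have h3 : ∫ y in Set.Ioi (0 : ℝ),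
      (Set.Ioc (0 : ℝ) 1).indicator (fun v => 1 / (1 + T * v ^ (-η / 2))) y =
      meanAttenuation T η := by
    rw [setIntegral_indicator measurableSet_Ioc, meanAttenuation,
      Set.inter_eq_right.2 Set.Ioc_subset_Ioi_self, integral_Ioc_eq_integral_Ioo]
  rw [h3] at h2
  rw [intervalIntegral.integral_of_le hr.le]
  have h4 : ∫ y in Set.Ioc 0 r, 1 / (1 + T * r ^ η * y ^ (-η)) * (2 * y / r ^ 2) =
      ∫ y in Set.Ioi 0, r⁻¹ * ((2 * (r⁻¹ * y) ^ ((2 : ℝ) - 1)) •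
        (Set.Ioc (0 : ℝ) 1).indicator (fun v => 1 / (1 + T * v ^ (-η / 2)))
          ((r⁻¹ * y) ^ (2 : ℝ))) := by
    rw [← integral_indicator measurableSet_Ioc, ← integral_indicator measurableSet_Ioi]
    refine integral_congr_ae (Filter.Eventually.of_forall fun y => ?_)
    by_cases hy : 0 < y
    · rw [Set.indicator_of_mem (Set.mem_Ioi.2 hy)]
      have hry : 0 < r⁻¹ * y := by positivity
      have hpow : (r⁻¹ * y) ^ (2 : ℝ) = (r⁻¹ * y) ^ 2 := by norm_cast
      have hiff : (r⁻¹ * y) ^ (2 : ℝ) ∈ Set.Ioc (0 : ℝ) 1 ↔ y ∈ Set.Ioc 0 r := by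
        rw [hpow, Set.mem_Ioc, Set.mem_Ioc, sq_le_one_iff₀ hry.le, inv_mul_le_one₀ hr]
        exact and_congr_left fun _ => iff_of_true (by positivity) hy
      by_cases hyr : y ∈ Set.Ioc 0 r
      · rw [Set.indicator_of_mem hyr, Set.indicator_of_mem (hiff.2 hyr)]
        have e1 : ((r⁻¹ * y) ^ (2 : ℝ)) ^ (-η / 2) = r ^ η * y ^ (-η) := by
          rw [← Real.rpow_mul hry.le, show 2 * (-η / 2) = -η by ring,
            Real.mul_rpow (by positivity) hy.le, Real.inv_rpow hr.le, Real.rpow_neg hr.le, inv_inv]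
        rw [e1, show (2 : ℝ) - 1 = 1 by norm_num, Real.rpow_one, smul_eq_mul]
        rw [← mul_assoc T]
        field_simp
      · rw [Set.indicator_of_notMem hyr, Set.indicator_of_notMem (fun h => hyr (hiff.1 h))]
        simp
    · rw [Set.indicator_of_notMem (fun h => hy h.1),
        Set.indicator_of_notMem (show y ∉ Set.Ioi 0 from hy)]
  rw [h4, integral_const_mul, h2]
  field_simp

namespace IsPoissonPointProcess

variable {Ω : Type*} [MeasurableSpace Ω] {μ : Measure Ω} {lam : ℝ}
  {X : ℕ → Ω → EuclideanSpace ℝ (Fin 2)}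

theorem measurable_dist (hX : IsPoissonPointProcess X (ENNReal.ofReal lam • volume) μ)
    (u : EuclideanSpace ℝ (Fin 2)) : Measurable fun ω n => dist u (X n ω) :=
  measurable_pi_lambda _ fun n => measurable_const.dist (hX.measurable n)

variable [IsProbabilityMeasure μ]

/-- The probability that the nearest point is closer than a given fraction of the distance of the
second nearest one. -/
theorem measureReal_nearest_lt_mul_second
    (hX : IsPoissonPointProcess X (ENNReal.ofReal lam • volume) μ)
    (hlam : 0 < lam) (u : EuclideanSpace ℝ (Fin 2)) {q : ℝ} (hq : q ∈ Set.Ioc (0 : ℝ) 1)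
    {r R : Ω → ℝ} (hr : r = fun ω => dist u (X (nearestIdx fun n => dist u (X n ω)) ω))
    (hR : R = fun ω => dist u (X (secondNearestIdx fun n => dist u (X n ω)) ω))
    {b : ℝ} (hb : 0 ≤ b) :
    μ.real {ω | b < R ω ∧ r ω < q * R ω} = q ^ 2 * μ.real {ω | b < R ω} := by
  have hrm : Measurable r := hr ▸ measurable_nearest_dist.comp (hX.measurable_dist u)
  have hRm : Measurable R := hR ▸ measurable_secondNearest_dist.comp (hX.measurable_dist u)
  have hlt : ∀ᵐ ω ∂μ, r ω < R ω := by
    filter_upwards [hX.ae_injective_dist hlam u, hX.ae_finite_sublevel u] with ω h1 h2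
    rw [hr, hR]
    exact nearestIdx_lt_secondNearestIdx h1 h2
  let W : ℝ → ℝ → Ω → ℝ := fun q a ω => if r ω ≤ q * a then 1 else 0
  have hW (q : ℝ) : Measurable fun p : ℝ × Ω => W q p.1 p.2 :=
    Measurable.ite (measurableSet_le (hrm.comp measurable_snd) (measurable_fst.const_mul q))
      measurable_const measurable_const
  have hW1 (q a : ℝ) (ω : Ω) : |W q a ω| ≤ 1 := by
    simp only [W]
    split_ifs <;> simp
  -- With the left end `s` frozen, `q s ≤ s` and the joint law of the two distances is explicit; `q`
  -- enters only through the factor `q ^ 2`, so comparison with `q = 1` needs no integration.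
  have hWcell {q : ℝ} (hq : q ∈ Set.Ioc (0 : ℝ) 1) {s a : ℝ} (hs : 0 ≤ s) (hsa : s < a) :
      ∫ ω in R ⁻¹' Set.Ioc s a, W q s ω ∂μ = q ^ 2 * (Real.pi * lam * s ^ 2 *
        (Real.exp (-(Real.pi * lam * s ^ 2)) - Real.exp (-(Real.pi * lam * a ^ 2)))) := by
    have hqs : q * s ≤ s := mul_le_of_le_one_left hs hq.2
    have hqs0 : 0 ≤ q * s := mul_nonneg hq.1.le hs
    have key {c : ℝ} (hc : s ≤ c) : ∫ ω in R ⁻¹' Set.Ioi c, W q s ω ∂μ =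
        Real.pi * lam * (q * s) ^ 2 * Real.exp (-(Real.pi * lam * c ^ 2)) := by
      rw [← hX.measureReal_nearest_le_and_lt_second hlam u hqs0 (hqs.trans hc)]
      have hms : MeasurableSet {ω | r ω ≤ q * s ∧ c < R ω} :=
        (measurableSet_le hrm measurable_const).inter (measurableSet_lt measurable_const hRm)
      have e1 : {ω | dist u (X (nearestIdx fun n => dist u (X n ω)) ω) ≤ q * s ∧
          c < dist u (X (secondNearestIdx fun n => dist u (X n ω)) ω)} =
          {ω | r ω ≤ q * s ∧ c < R ω} := by rw [hr, hR]
      rw [e1, ← integral_indicator_one hms, ← integral_indicator (hRm measurableSet_Ioi)]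
      refine integral_congr_ae (Filter.Eventually.of_forall fun ω => ?_)
      by_cases h1 : c < R ω
      · rw [Set.indicator_of_mem (show ω ∈ R ⁻¹' Set.Ioi c from h1)]
        by_cases h2 : r ω ≤ q * s
        · rw [Set.indicator_of_mem (show ω ∈ {ω | r ω ≤ q * s ∧ c < R ω} from ⟨h2, h1⟩)]
          exact if_pos h2
        · rw [Set.indicator_of_notMem (fun h => h2 h.1)]
          exact if_neg h2
      · rw [Set.indicator_of_notMem (show ω ∉ R ⁻¹' Set.Ioi c from h1),
          Set.indicator_of_notMem (fun h => h1 h.2)]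
    have hset : R ⁻¹' Set.Ioc s a = R ⁻¹' Set.Ioi s \ R ⁻¹' Set.Ioi a := by
      rw [← Set.preimage_sdiff, Set.Ioi_sdiff_Ioi]
    have hint : Integrable (W q s) μ :=
      (integrable_const (1 : ℝ)).mono' ((hW q).comp measurable_prodMk_left).aestronglyMeasurable
        (Filter.Eventually.of_forall fun ω => hW1 _ _ _)
    rw [hset, setIntegral_sdiff (hRm measurableSet_Ioi) hint.integrableOn
      (Set.preimage_mono (Set.Ioi_subset_Ioi hsa.le)), key le_rfl, key hsa.le]
    ring
  -- Approaching `R` strictly from below turns `r ≤ q v` into the strict `r < q R`, with no boundary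
  -- case left over.
  have hlimW {q : ℝ} (hq : 0 < q) {ω : Ω} {v : ℕ → ℝ}
      (hv : Filter.Tendsto v Filter.atTop (nhds (R ω))) (hvR : ∀ j, v j < R ω) :
      Filter.Tendsto (fun j => W q (v j) ω) Filter.atTop
        (nhds (if r ω < q * R ω then 1 else 0)) := by
    split_ifs with h
    · refine tendsto_const_nhds.congr' ?_
      filter_upwards [(hv.const_mul q).eventually (lt_mem_nhds h)] with j hj
      exact (if_pos hj.le).symm
    · refine tendsto_const_nhds.congr fun j => ?_
      refine (if_neg fun h' => h (h'.trans_lt ?_)).symm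
      exact mul_lt_mul_of_pos_left (hvR j) hq
  have hq2 : q ^ 2 ≤ 1 := pow_le_one₀ hq.1.le hq.2
  have h := setIntegral_Ioi_eq_of_frozen (μ := μ) hRm (W := W q)
    (V := fun a ω => q ^ 2 * W 1 a ω) (W' := fun ω => if r ω < q * R ω then 1 else 0)
    (V' := fun ω => q ^ 2 * if r ω < 1 * R ω then 1 else 0) (hW q) ((hW 1).const_mul _) (hW1 q)
    (fun a ω => by
      rw [abs_mul, abs_of_nonneg (sq_nonneg q)]
      exact mul_le_one₀ hq2 (abs_nonneg _) (hW1 1 a ω)) (θ := 0) (by simp)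
    (fun s a hs hsa => by
      rw [zero_mul, add_zero, integral_const_mul, hWcell hq hs hsa,
        hWcell ⟨one_pos, le_rfl⟩ hs hsa, one_pow, one_mul])
    (Filter.Eventually.of_forall fun ω v hv _ hvR =>
      ⟨hlimW hq.1 hv (hvR rfl), (hlimW one_pos hv (hvR rfl)).const_mul _⟩) hb
  have hms : MeasurableSet {ω | b < R ω ∧ r ω < q * R ω} :=
    (measurableSet_lt measurable_const hRm).inter (measurableSet_lt hrm (hRm.const_mul q))
  rw [integral_const_mul] at h
  have hL : ∫ ω in R ⁻¹' Set.Ioi b, (if r ω < q * R ω then (1 : ℝ) else 0) ∂μ =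
      μ.real {ω | b < R ω ∧ r ω < q * R ω} := by
    rw [← integral_indicator_one hms, ← integral_indicator (hRm measurableSet_Ioi)]
    refine integral_congr_ae (Filter.Eventually.of_forall fun ω => ?_)
    by_cases h1 : b < R ω <;> by_cases h2 : r ω < q * R ω <;> simp [h1, h2]
  have hRR : ∫ ω in R ⁻¹' Set.Ioi b, (if r ω < 1 * R ω then (1 : ℝ) else 0) ∂μ =
      μ.real {ω | b < R ω} := by
    rw [← integral_indicator_one (measurableSet_lt measurable_const hRm),
      ← integral_indicator (hRm measurableSet_Ioi)]
    refine integral_congr_ae ?_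
    filter_upwards [hlt] with ω hω
    by_cases h1 : b < R ω <;> simp [h1, hω]
  rw [← hL, h, hRR]

/-- Given that the second nearest point is at distance greater than `b`, the squared ratio of the
two smallest distances is uniformly distributed. -/
theorem map_restrict_sq_ratio
    (hX : IsPoissonPointProcess X (ENNReal.ofReal lam • volume) μ)
    (hlam : 0 < lam) (u : EuclideanSpace ℝ (Fin 2))
    {r R : Ω → ℝ} (hr : r = fun ω => dist u (X (nearestIdx fun n => dist u (X n ω)) ω))
    (hR : R = fun ω => dist u (X (secondNearestIdx fun n => dist u (X n ω)) ω))
    {b : ℝ} (hb : 0 ≤ b) :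
    (μ.restrict {ω | b < R ω}).map (fun ω => (r ω / R ω) ^ 2) =
      μ {ω | b < R ω} • volume.restrict (Set.Ioo (0 : ℝ) 1) := by
  have hrm : Measurable r := hr ▸ measurable_nearest_dist.comp (hX.measurable_dist u)
  have hRm : Measurable R := hR ▸ measurable_secondNearest_dist.comp (hX.measurable_dist u)
  have hr0 (ω : Ω) : 0 ≤ r ω := by rw [hr]; exact dist_nonneg
  have hlt : ∀ᵐ ω ∂μ, r ω < R ω := by
    filter_upwards [hX.ae_injective_dist hlam u, hX.ae_finite_sublevel u] with ω h1 h2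
    rw [hr, hR]
    exact nearestIdx_lt_secondNearestIdx h1 h2
  have hvm : Measurable fun ω => (r ω / R ω) ^ 2 := (hrm.div hRm).pow_const 2
  have hbm : MeasurableSet {ω | b < R ω} := measurableSet_lt measurable_const hRm
  refine Measure.ext_of_Ici _ _ fun x => ?_
  rw [Measure.map_apply hvm measurableSet_Ici, Measure.restrict_apply (hvm measurableSet_Ici),
    Measure.smul_apply, Measure.restrict_apply measurableSet_Ici, smul_eq_mul]
  rcases le_or_gt x 0 with hx | hx
  · have h1 : (fun ω => (r ω / R ω) ^ 2) ⁻¹' Set.Ici x = Set.univ :=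
      Set.eq_univ_of_forall fun ω => hx.trans (sq_nonneg (r ω / R ω))
    have h2 : Set.Ici x ∩ Set.Ioo (0 : ℝ) 1 = Set.Ioo 0 1 :=
      Set.inter_eq_right.2 fun y hy => hx.trans hy.1.le
    rw [h1, h2, Set.univ_inter, Real.volume_Ioo]
    simp
  · have h2 : volume (Set.Ici x ∩ Set.Ioo (0 : ℝ) 1) = ENNReal.ofReal (1 - x) := by
      have : Set.Ici x ∩ Set.Ioo (0 : ℝ) 1 = Set.Ico x 1 := by
        ext y
        simp only [Set.mem_inter_iff, Set.mem_Ici, Set.mem_Ioo, Set.mem_Ico]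
        exact ⟨fun h => ⟨h.1, h.2.2⟩, fun h => ⟨h.1, hx.trans_le h.1, h.2⟩⟩
      rw [this, Real.volume_Ico]
    rw [h2]
    rcases le_or_gt x 1 with hx1 | hx1
    · set q := √x
      have hq : q ∈ Set.Ioc (0 : ℝ) 1 :=
        ⟨Real.sqrt_pos.2 hx, Real.sqrt_le_one.2 hx1⟩
      have hq2 : q ^ 2 = x := Real.sq_sqrt hx.le
      have h3 := hX.measureReal_nearest_lt_mul_second hlam u hq hr hR hb
      -- With `q = √x`, the event that the squared ratio is at least `x` is the complement, inside
      -- `{b < R}`, of `{r < q R}`.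
      have h4 : (fun ω => (r ω / R ω) ^ 2) ⁻¹' Set.Ici x ∩ {ω | b < R ω} =
          {ω | b < R ω} \ {ω | b < R ω ∧ r ω < q * R ω} := by
        ext ω
        change x ≤ (r ω / R ω) ^ 2 ∧ b < R ω ↔ b < R ω ∧ ¬ (b < R ω ∧ r ω < q * R ω)
        rw [and_comm]
        refine and_congr_right fun hω => ?_
        have hRω : 0 < R ω := hb.trans_lt hω
        rw [not_and, not_lt, ← le_div_iff₀ hRω, ← hq2,
          pow_le_pow_iff_left₀ hq.1.le (div_nonneg (hr0 ω) hRω.le) two_ne_zero]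
        exact ⟨fun h _ => h, fun h => h hω⟩
      have h5 : μ.real ({ω | b < R ω} \ {ω | b < R ω ∧ r ω < q * R ω}) =
          μ.real {ω | b < R ω} * (1 - x) := by
        have hms : MeasurableSet {ω | b < R ω ∧ r ω < q * R ω} :=
          hbm.inter (measurableSet_lt hrm (hRm.const_mul q))
        have hsub : {ω | b < R ω ∧ r ω < q * R ω} ⊆ {ω | b < R ω} := fun ω h => h.1
        rw [measureReal_sdiff hsub hms, h3, hq2]
        ring
      rw [h4, ← ENNReal.ofReal_toReal (measure_ne_top μ (_ \ _)), ← measureReal_def, h5,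
        ENNReal.ofReal_mul measureReal_nonneg, measureReal_def,
        ENNReal.ofReal_toReal (measure_ne_top μ _)]
    · rw [ENNReal.ofReal_of_nonpos (by linarith), mul_zero]
      refine measure_mono_null (t := {ω | ¬ r ω < R ω}) ?_ hlt
      rintro ω ⟨h1 : x ≤ (r ω / R ω) ^ 2, h2 : b < R ω⟩ h3
      have hRω : 0 < R ω := hb.trans_lt h2
      have h4 : r ω / R ω ≤ 1 := (div_le_one hRω).2 h3.le
      have h5 : (r ω / R ω) ^ 2 ≤ 1 := pow_le_one₀ (div_nonneg (hr0 ω) hRω.le) h4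
      linarith

/-- The averaged attenuation caused by the nearest point, for a receiver served by the second
nearest one. -/
theorem setIntegral_attenuation_nearest
    (hX : IsPoissonPointProcess X (ENNReal.ofReal lam • volume) μ)
    (hlam : 0 < lam) (u : EuclideanSpace ℝ (Fin 2)) (T η : ℝ)
    {r R : Ω → ℝ} (hr : r = fun ω => dist u (X (nearestIdx fun n => dist u (X n ω)) ω))
    (hR : R = fun ω => dist u (X (secondNearestIdx fun n => dist u (X n ω)) ω))
    {b : ℝ} (hb : 0 ≤ b) :
    ∫ ω in R ⁻¹' Set.Ioi b, 1 / (1 + T * R ω ^ η * r ω ^ (-η)) ∂μ =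
      ∫ _ in R ⁻¹' Set.Ioi b, meanAttenuation T η ∂μ := by
  have hrm : Measurable r := hr ▸ measurable_nearest_dist.comp (hX.measurable_dist u)
  have hRm : Measurable R := hR ▸ measurable_secondNearest_dist.comp (hX.measurable_dist u)
  have hr0 (ω : Ω) : 0 ≤ r ω := by rw [hr]; exact dist_nonneg
  have hvm : Measurable fun ω => (r ω / R ω) ^ 2 := (hrm.div hRm).pow_const 2
  have hψ : Measurable fun v : ℝ => 1 / (1 + T * v ^ (-η / 2)) := by fun_prop
  have h1 : ∫ ω in R ⁻¹' Set.Ioi b, 1 / (1 + T * R ω ^ η * r ω ^ (-η)) ∂μ =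
      ∫ ω in R ⁻¹' Set.Ioi b, 1 / (1 + T * ((r ω / R ω) ^ 2) ^ (-η / 2)) ∂μ := by
    refine setIntegral_congr_fun (hRm measurableSet_Ioi) fun ω hω => ?_
    have hRω : 0 < R ω := hb.trans_lt hω
    have hp : 0 ≤ r ω / R ω := div_nonneg (hr0 ω) hRω.le
    rw [← Real.rpow_natCast (r ω / R ω) 2, ← Real.rpow_mul hp,
      show ((2 : ℕ) : ℝ) * (-η / 2) = -η by push_cast; ring, Real.div_rpow (hr0 ω) hRω.le,
      Real.rpow_neg hRω.le η, div_inv_eq_mul]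
    ring
  have h2 := integral_map (μ := μ.restrict {ω | b < R ω}) hvm.aemeasurable
    hψ.aestronglyMeasurable
  rw [hX.map_restrict_sq_ratio hlam u hr hR hb, integral_smul_measure] at h2
  rw [h1, setIntegral_const, meanAttenuation]
  exact h2.symm

end IsPoissonPointProcess

/-! ### Conditional Laplace transforms. -/

/-- The conditional Laplace transform, given `R`, of a sum of exponential gains weighted by
functions of the environment, once the gain-averaged integrals over `{b < R}` are known. -/
theorem condExp_exp_neg_tsum_mul_ae_eq {Ω S : Type*} [MeasurableSpace Ω] [MeasurableSpace S]
    {μ : Measure Ω} [IsProbabilityMeasure μ] {h : ℕ → Ω → ℝ} (hh_meas : ∀ n, Measurable (h n))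
    (hh_law : ∀ n, μ.map (h n) = expMeasure 1) (hh_indep : iIndepFun h μ)
    {Y : Ω → S} (hY : Measurable Y) (hYh : IndepFun Y (fun ω n => h n ω) μ)
    {t : ℕ → S → ℝ} (htm : ∀ n, Measurable (t n)) (ht : ∀ n y, 0 ≤ t n y)
    (hts : ∀ᵐ ω ∂μ, Summable fun n => t n (Y ω)) {ρ : S → ℝ} (hρ : Measurable ρ)
    (hρ0 : ∀ᵐ ω ∂μ, 0 < ρ (Y ω)) {g : ℝ → ℝ} (hg : Measurable g) (hg0 : ∀ r, 0 ≤ g r)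
    {C : ℝ} (hgC : ∀ r, g r ≤ C)
    (hint : ∀ b, 0 ≤ b → ∫ ω in (fun ω => ρ (Y ω)) ⁻¹' Set.Ioi b,
      Real.exp (-∑' n, Real.log (1 + t n (Y ω))) ∂μ =
        ∫ ω in (fun ω => ρ (Y ω)) ⁻¹' Set.Ioi b, g (ρ (Y ω)) ∂μ) :
    μ[fun ω => Real.exp (-∑' n, t n (Y ω) * h n ω) |
      MeasurableSpace.comap (fun ω => ρ (Y ω)) inferInstance] =ᵐ[μ] fun ω => g (ρ (Y ω)) := by
  have hm : Measurable fun ω => Real.exp (-∑' n, t n (Y ω) * h n ω) :=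
    Real.measurable_exp.comp (Measurable.neg (Measurable.tsum fun n =>
      ((htm n).comp hY).mul (hh_meas n)))
  refine condExp_comap_ae_eq_of_setIntegral_Ioi (hρ.comp hY) hρ0 ?_
    (Filter.Eventually.of_forall fun ω => (Real.exp_pos _).le) hg ?_
    (Filter.Eventually.of_forall fun ω => hg0 _) ?_
  · refine (integrable_const (1 : ℝ)).mono' hm.aestronglyMeasurable ?_
    filter_upwards [ae_nonneg_of_map_eq_expMeasure_one hh_meas hh_law] with ω hω
    rw [Real.norm_eq_abs, Real.abs_exp, Real.exp_le_one_iff, neg_nonpos]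
    exact tsum_nonneg fun n => mul_nonneg (ht n _) (hω n)
  · refine (integrable_const C).mono' (hg.comp (hρ.comp hY)).aestronglyMeasurable
      (Filter.Eventually.of_forall fun ω => ?_)
    rw [Real.norm_eq_abs, abs_of_nonneg (hg0 _)]
    exact hgC _
  · intro b hb
    refine Eq.trans ?_ (hint b hb)
    exact (setIntegral_exp_neg_tsum_mul hh_meas hh_law hh_indep hY hYh htm ht hts).2
      (ρ ⁻¹' Set.Ioi b) (hρ measurableSet_Ioi)

namespace IsPoissonPointProcess

variable {Ω : Type*} [MeasurableSpace Ω] {μ : Measure Ω} [IsProbabilityMeasure μ] {lam : ℝ}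
  {X : ℕ → Ω → EuclideanSpace ℝ (Fin 2)}

/-- The conditional Laplace transform of the interference from beyond the distance `R` of a point,
when the events `{s < R}` are determined by the number of points within distance `s`. -/
theorem condLaplace_interference_ae_eq
    (hX : IsPoissonPointProcess X (ENNReal.ofReal lam • volume) μ)
    {P η T : ℝ} (hlam : 0 < lam) (hP : 0 < P) (hη : 2 < η) (hT : 0 < T)
    {h : ℕ → Ω → ℝ} (hh_meas : ∀ n, Measurable (h n))
    (hh_law : ∀ n, μ.map (h n) = expMeasure 1) (hh_indep : iIndepFun h μ)
    (hXh : IndepFun (fun ω n => X n ω) (fun ω n => h n ω) μ) (u : EuclideanSpace ℝ (Fin 2))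
    {ρ : (ℕ → ℝ) → ℝ} (hρ : Measurable ρ) (hρ0 : ∀ d, (∀ n, 0 ≤ d n) → 0 ≤ ρ d)
    (hpos : ∀ᵐ ω ∂μ, 0 < ρ fun n => dist u (X n ω)) {i : ℝ≥0∞}
    (hi : ∀ᵐ ω ∂μ, ∀ s, s < ρ (fun n => dist u (X n ω)) ↔
      pointCount (fun n => X n ω) (Metric.closedBall u s) ≤ i)
    {S : Ω → Set ℕ} (hS : ∀ᵐ ω ∂μ, ∀ n, ρ (fun n => dist u (X n ω)) < dist u (X n ω) ↔ n ∉ S ω) :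
    condLaplace μ
      (fun ω => interferenceExcept P η (fun n => h n ω) (fun n => dist u (X n ω)) (S ω))
      (fun ω => ρ fun n => dist u (X n ω)) (fun r => T * r ^ η / P) =ᵐ[μ]
    fun ω => Real.exp (-(Real.pi * lam * ρ (fun n => dist u (X n ω)) ^ 2 * vartheta T η)) := by
  have hxm : Measurable fun ω n => X n ω := measurable_pi_lambda _ hX.measurable
  have hdm (n : ℕ) : Measurable fun x : ℕ → EuclideanSpace ℝ (Fin 2) => dist u (x n) :=
    measurable_const.dist (measurable_pi_apply n)
  let ρ' : (ℕ → EuclideanSpace ℝ (Fin 2)) → ℝ := fun x => ρ fun n => dist u (x n)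
  have hρ' : Measurable ρ' := hρ.comp (measurable_pi_lambda _ hdm)
  have hρ'0 (x : ℕ → EuclideanSpace ℝ (Fin 2)) : 0 ≤ ρ' x := hρ0 _ fun n => dist_nonneg
  -- The excluded index set is replaced by the cutoff at distance `ρ'`; the two agree almost surely
  -- by `hS`. The power `P` cancels in these weights.
  let t : ℕ → (ℕ → EuclideanSpace ℝ (Fin 2)) → ℝ := fun n x =>
    if ρ' x < dist u (x n) then T * ρ' x ^ η * dist u (x n) ^ (-η) else 0
  have htm (n : ℕ) : Measurable (t n) :=
    Measurable.ite (measurableSet_lt hρ' (hdm n))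
      (((hρ'.pow_const η).const_mul T).mul ((hdm n).pow_const (-η))) measurable_const
  have ht (n : ℕ) (x : ℕ → EuclideanSpace ℝ (Fin 2)) : 0 ≤ t n x := by
    have := hρ'0 x
    simp only [t]
    split_ifs <;> positivity
  have hts : ∀ᵐ ω ∂μ, Summable fun n => t n fun k => X k ω := by
    filter_upwards [hX.ae_summable_dist_rpow u hη] with ω hω
    refine (hω.mul_left (T * ρ' (fun k => X k ω) ^ η)).of_nonneg_of_le (fun n => ht n _)
      fun n => ?_
    have := hρ'0 fun k => X k ω
    simp only [t]
    split_ifs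
    · exact le_rfl
    · positivity
  have hlog (n : ℕ) (x : ℕ → EuclideanSpace ℝ (Fin 2)) :
      Real.log (1 + t n x) = logAttenuation T η (ρ' x) (dist u (x n)) := by
    simp only [t, logAttenuation]
    split_ifs <;> simp
  have hmain := condExp_exp_neg_tsum_mul_ae_eq hh_meas hh_law hh_indep hxm hXh htm ht hts hρ' hpos
    (g := fun r => Real.exp (-(Real.pi * lam * r ^ 2 * vartheta T η))) (by fun_prop)
    (fun r => (Real.exp_pos _).le) (C := 1)
    (fun r => by
      rw [Real.exp_le_one_iff, neg_nonpos]
      have := vartheta_nonneg hT η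
      have := Real.pi_pos
      positivity)
    (fun b hb => by
      simp only [hlog]
      exact hX.setIntegral_exp_neg_tsum_logAttenuation hlam u hT hη (hρ'.comp hxm) hpos hi hb)
  refine Filter.EventuallyEq.trans (condExp_congr_ae ?_) hmain
  filter_upwards [hS] with ω hω
  rw [interferenceExcept, neg_mul, ← tsum_mul_left]
  congr 2
  refine tsum_congr fun n => ?_
  by_cases hn : n ∈ S ω
  · rw [Set.indicator_of_notMem (show n ∉ (S ω)ᶜ from not_not.2 hn), mul_zero,
      show t n (fun k => X k ω) = 0 from if_neg fun h => (hω n).1 h hn, zero_mul]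
  · rw [Set.indicator_of_mem (show n ∈ (S ω)ᶜ from hn), show t n (fun k => X k ω) = _ from
      if_pos ((hω n).2 hn), rxPower]
    simp only [ρ']
    field_simp

/-- The nearest station is a sum over all stations with a single nonzero weight, so the general
averaging result applies with the constant function `meanAttenuation T η`. -/
theorem condLaplace_nearest_ae_eq
    (hX : IsPoissonPointProcess X (ENNReal.ofReal lam • volume) μ)
    {P η T : ℝ} (hlam : 0 < lam) (hP : 0 < P) (hT : 0 < T)
    {h : ℕ → Ω → ℝ} (hh_meas : ∀ n, Measurable (h n))
    (hh_law : ∀ n, μ.map (h n) = expMeasure 1) (hh_indep : iIndepFun h μ)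
    (hXh : IndepFun (fun ω n => X n ω) (fun ω n => h n ω) μ) (u : EuclideanSpace ℝ (Fin 2))
    {r R : Ω → ℝ} (hr : r = fun ω => dist u (X (nearestIdx fun n => dist u (X n ω)) ω))
    (hR : R = fun ω => dist u (X (secondNearestIdx fun n => dist u (X n ω)) ω)) :
    condLaplace μ (fun ω => rxPower P η (h (nearestIdx fun n => dist u (X n ω)) ω) (r ω)) R
      (fun r => T * r ^ η / P) =ᵐ[μ]
    fun ω => ∫ y in (0 : ℝ)..(R ω), 1 / (1 + T * R ω ^ η * y ^ (-η)) * (2 * y / R ω ^ 2) := by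
  have hxm : Measurable fun ω n => X n ω := measurable_pi_lambda _ hX.measurable
  have hdm (n : ℕ) : Measurable fun x : ℕ → EuclideanSpace ℝ (Fin 2) => dist u (x n) :=
    measurable_const.dist (measurable_pi_apply n)
  have hdm' := measurable_pi_lambda _ hdm
  let k : (ℕ → EuclideanSpace ℝ (Fin 2)) → ℕ := fun x => nearestIdx fun n => dist u (x n)
  have hk : Measurable k := measurable_nearestIdx.comp hdm'
  let ρ : (ℕ → EuclideanSpace ℝ (Fin 2)) → ℝ := fun x =>
    dist u (x (secondNearestIdx fun n => dist u (x n)))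
  have hρ : Measurable ρ := measurable_secondNearest_dist.comp hdm'
  have hpos : ∀ᵐ ω ∂μ, 0 < R ω := by
    filter_upwards [hX.ae_dist_pos hlam u] with ω hω
    rw [hR]
    exact hω _
  let t : ℕ → (ℕ → EuclideanSpace ℝ (Fin 2)) → ℝ := fun n x =>
    if k x = n then T * ρ x ^ η * dist u (x n) ^ (-η) else 0
  have htm (n : ℕ) : Measurable (t n) :=
    Measurable.ite (hk (measurableSet_singleton n))
      (((hρ.pow_const η).const_mul T).mul ((hdm n).pow_const (-η))) measurable_const
  have ht0 {n : ℕ} {x : ℕ → EuclideanSpace ℝ (Fin 2)} (hn : n ≠ k x) : t n x = 0 :=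
    if_neg hn.symm
  have htk (x : ℕ → EuclideanSpace ℝ (Fin 2)) :
      t (k x) x = T * ρ x ^ η * dist u (x (k x)) ^ (-η) := if_pos rfl
  have ht (n : ℕ) (x : ℕ → EuclideanSpace ℝ (Fin 2)) : 0 ≤ t n x := by
    simp only [t, ρ]
    split_ifs <;> positivity
  have hts : ∀ᵐ ω ∂μ, Summable fun n => t n fun k => X k ω :=
    Filter.Eventually.of_forall fun ω =>
      summable_of_ne_finset_zero (s := {k fun k => X k ω}) fun n hn =>
        ht0 (by simpa using hn)
  have hmean : 0 ≤ meanAttenuation T η := setIntegral_nonneg measurableSet_Ioo fun v hv => by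
    have := hv.1
    positivity
  have hmain := condExp_exp_neg_tsum_mul_ae_eq hh_meas hh_law hh_indep hxm hXh htm ht hts hρ
    (by rw [hR] at hpos; exact hpos) (g := fun _ => meanAttenuation T η) measurable_const
    (fun _ => hmean) (fun _ => le_rfl)
    (fun b hb => by
      have h1 := hX.setIntegral_attenuation_nearest hlam u T η hr hR hb
      rw [hR] at h1
      refine Eq.trans (integral_congr_ae (Filter.Eventually.of_forall fun ω => ?_)) h1
      beta_reduce
      rw [tsum_eq_single (k fun k => X k ω) fun n hn => by rw [ht0 hn, add_zero, Real.log_one],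
        Real.exp_neg, Real.exp_log (by linarith [ht (k fun k => X k ω) fun k => X k ω]), htk,
        one_div, hr])
  have hRρ : R = fun ω => ρ fun n => X n ω := hR
  have hgoal : (fun _ : Ω => meanAttenuation T η) =ᵐ[μ] fun ω =>
      ∫ y in (0 : ℝ)..(R ω), 1 / (1 + T * R ω ^ η * y ^ (-η)) * (2 * y / R ω ^ 2) := by
    filter_upwards [hpos] with ω hω
    exact (intervalIntegral_attenuation_eq hω T η).symm
  refine Filter.EventuallyEq.trans ?_ hgoal
  rw [condLaplace, hRρ]
  refine Filter.EventuallyEq.trans (condExp_congr_ae (Filter.Eventually.of_forall fun ω => ?_))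
    hmain
  beta_reduce
  rw [tsum_eq_single (k fun k => X k ω) fun n hn => by rw [ht0 hn, zero_mul], htk, hr, rxPower]
  congr 1
  simp only [k]
  field_simp

end IsPoissonPointProcess

theorem lemma2 {Ω : Type*} [MeasurableSpace Ω] (μ : Measure Ω) [IsProbabilityMeasure μ]
    (lam P η T : ℝ) (hlam : 0 < lam) (hP : 0 < P) (hη : 2 < η) (hT : 0 < T)
    -- the base stations: a homogeneous Poisson point process of intensity `lam` in the plane
    (X : ℕ → Ω → EuclideanSpace ℝ (Fin 2))
    (hX : IsPoissonPointProcess X (ENNReal.ofReal lam • volume) μ)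
    -- the channel power gains: i.i.d. unit-mean exponential, independent of the base stations
    (h : ℕ → Ω → ℝ) (hh_meas : ∀ n, Measurable (h n))
    (hh_law : ∀ n, μ.map (h n) = expMeasure 1)
    (hh_indep : iIndepFun h μ)
    (hXh : IndepFun (fun ω n => X n ω) (fun ω n => h n ω) μ)
    -- the location of the test user
    (u : EuclideanSpace ℝ (Fin 2)) :
    let d : Ω → ℕ → ℝ := fun ω n => dist u (X n ω)
    let gain : Ω → ℕ → ℝ := fun ω n => h n ω
    let near : Ω → ℕ := fun ω => nearestIdx (d ω)
    let second : Ω → ℕ := fun ω => secondNearestIdx (d ω)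
    -- the total received power converges almost surely
    (∀ᵐ ω ∂μ, Summable fun n => rxPower P η (gain ω n) (d ω n)) ∧
    -- best connected case: the serving station is the nearest one
    (let r₀ : Ω → ℝ := fun ω => d ω (near ω)
     let I_r : Ω → ℝ := fun ω => interferenceExcept P η (gain ω) (d ω) {near ω}
     condLaplace μ I_r r₀ (fun r => T * r ^ η / P) =ᵐ[μ]
        fun ω => Real.exp (-(Real.pi * lam * r₀ ω ^ 2 * vartheta T η))) ∧
    -- blackout case: the nearest station is skipped, the second nearest one is serving
    (let r₀ : Ω → ℝ := fun ω => d ω (second ω)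
     let I_r : Ω → ℝ := fun ω => interferenceExcept P η (gain ω) (d ω) {second ω, near ω}
     let I₁ : Ω → ℝ := fun ω => rxPower P η (gain ω (near ω)) (d ω (near ω))
     condLaplace μ I_r r₀ (fun r => T * r ^ η / P) =ᵐ[μ]
        (fun ω => Real.exp (-(Real.pi * lam * r₀ ω ^ 2 * vartheta T η))) ∧
     condLaplace μ I₁ r₀ (fun r => T * r ^ η / P) =ᵐ[μ]
        fun ω => ∫ r in (0 : ℝ)..(r₀ ω),
          1 / (1 + T * r₀ ω ^ η * r ^ (-η)) * (2 * r / r₀ ω ^ 2)) := by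
  intro d gain near second
  have hdm : Measurable d := hX.measurable_dist u
  refine ⟨?_, ?_, ?_, ?_⟩
  · have hxm : Measurable fun ω n => X n ω := measurable_pi_lambda _ hX.measurable
    have h1 := (setIntegral_exp_neg_tsum_mul hh_meas hh_law hh_indep hxm hXh
      (t := fun n x => dist u (x n) ^ (-η))
      (fun n => (measurable_const.dist (measurable_pi_apply n)).pow_const _)
      (fun n x => Real.rpow_nonneg dist_nonneg _) (hX.ae_summable_dist_rpow u hη)).1
    filter_upwards [h1] with ω hω
    refine (hω.mul_left P).congr fun n => ?_
    simp only [rxPower, gain, d]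
    ring
  -- Here `i = 0`: the nearest distance exceeds `s` when the disc of radius `s` is empty.
  · refine hX.condLaplace_interference_ae_eq hlam hP hη hT hh_meas hh_law hh_indep hXh u
      measurable_nearest_dist (fun d hd => hd _) ?_ (i := 0) ?_ ?_
    · filter_upwards [hX.ae_dist_pos hlam u] with ω hω using hω _
    · filter_upwards [hX.ae_finite_sublevel u] with ω hω s
      rw [lt_nearestIdx_iff hω, pointCount_closedBall, ← ENat.toENNReal_zero, ENat.toENNReal_le]
    · filter_upwards [hX.ae_injective_dist hlam u, hX.ae_finite_sublevel u] with ω h1 h2 n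
      exact nearestIdx_lt_iff h1 h2 n
  -- Here `i = 1`: the second distance exceeds `s` when the disc holds at most one station.
  · refine hX.condLaplace_interference_ae_eq hlam hP hη hT hh_meas hh_law hh_indep hXh u
      measurable_secondNearest_dist (fun d hd => hd _) ?_ (i := 1) ?_ ?_
    · filter_upwards [hX.ae_dist_pos hlam u] with ω hω using hω _
    · filter_upwards [hX.ae_finite_sublevel u] with ω hω s
      rw [lt_secondNearestIdx_iff hω, pointCount_closedBall, ← ENat.toENNReal_one,
        ENat.toENNReal_le]
    · filter_upwards [hX.ae_injective_dist hlam u, hX.ae_finite_sublevel u] with ω h1 h2 n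
      refine (secondNearestIdx_lt_iff h1 h2 n).trans ?_
      simp [second, near, d]
  · exact hX.condLaplace_nearest_ae_eq hlam hP hT hh_meas hh_law hh_indep hXh u rfl rfl
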